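/- Let $n\in\mathbb N$. For real $\alpha\ge\beta\ge 2$ and $x\in\mathbb R^n$ put $W_{\alpha,\beta}(x)=|x|^\alpha/\alpha-|x|^\beta/\beta$, and let $W_{\infty,\beta}(x)=-|x|^\beta/\beta$ if $|x|\le 1$ and $W_{\infty,\beta}(x)=+\infty$ if $|x|>1$. For a Borel probability measure $\mu$ on $\mathbb R^n$ and $W\in\{W_{\alpha,\beta},W_{\infty,\beta}\}$ let $\mathcal E_W(\mu)=\iint W(x-y)\,d\mu(x)\,d\mu(y)\in(-\infty,+\infty]$ and $(\mu*W)(x)=\int W(x-y)\,d\mu(y)$. Let $\mathcal P(\mathbb R^n)$ be the set of all Borel probability measures on $\mathbb R^n$, and $\mathcal P_0(\mathbb R^n)$ the set of those with finite second moment and barycenter $\int x\,d\mu(x)=0$. Let $\hat M_0$ be the set of those $\mu\in\mathcal P_0(\mathbb R^n)$ that minimize $\mathcal E_{W_{\infty,\beta}}$ over $\mathcal P(\mathbb R^n)$. Let $d_2(\mu,\nu)=\inf\|X-Y\|_{L^2}$, the infimum being over all pairs of random vectors $X\sim\mu$, $Y\sim\nu$ on a common probability space, and $d_2(\mu,\hat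 M_0)=\inf_{\nu\in\hat M_0}d_2(\mu,\nu)$. Fix $\beta\ge 2$ and $r>0$. Then there is $\alpha_0\in\mathbb R$ (depending only on $n$, $\beta$ and $r$) such that for every real $\alpha\ge\alpha_0$ and every minimizer $\mu_{\alpha,\beta}$ of $\mathcal E_{W_{\alpha,\beta}}$ over $\mathcal P_0(\mathbb R^n)$ there exists $\hat\mu\in\hat M_0$ such that every point of $\mathbb R^n$ at which $\mu_{\alpha,\beta}*W_{\alpha,\beta}$ attains its (global) minimum over $\mathbb R^n$ lies at distance less than $r$ from some point of the support of $\hat\mu$, and moreover $d_2(\mu_{\alpha,\beta},\hat\mu)=d_2(\mu_{\alpha,\beta},\hat M_0)$. -/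

import Mathlib

open MeasureTheory
open scoped ENNReal

noncomputable section

namespace MildRepulsion

/-- The Euclidean space of dimension `n`. -/
abbrev E (n : ℕ) : Type := EuclideanSpace ℝ (Fin n)

/-- The set of minimizers of `F` over the set `s`. -/
def argmin {X : Type*} (s : Set X) (F : X → EReal) : Set X :=
  {x | x ∈ s ∧ IsMinOn F s x}

/-- The integral of an extended-real valued function, as the integral of its positive part minus
the integral of its negative part. For a probability measure and an integrand bounded from below
(such as the pair potentials below when `α ≥ β > 0`) the value lies in `(-∞, +∞]`. -/
def extIntegral {X : Type*} [MeasurableSpace X] (μ : Measure X) (f : X → EReal) : EReal :=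
  ((∫⁻ x, (f x).toENNReal ∂μ : ℝ≥0∞) : EReal) - ((∫⁻ x, (-f x).toENNReal ∂μ : ℝ≥0∞) : EReal)

/-- The power-law pair potential `|x| ^ α / α - |x| ^ β / β`. -/
def powerLaw {n : ℕ} (α β : ℝ) (x : E n) : EReal :=
  ((‖x‖ ^ α / α - ‖x‖ ^ β / β : ℝ) : EReal)

/-- The hard-confinement pair potential: `-|x| ^ β / β` if `|x| ≤ 1`, and `+∞` otherwise. -/
def hardConfinement {n : ℕ} (β : ℝ) (x : E n) : EReal :=
  if ‖x‖ ≤ 1 then ((-(‖x‖ ^ β / β) : ℝ) : EReal) else ⊤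

/-- The interaction energy `∬ W (x - y) dμ(x) dμ(y)`. -/
def energy {n : ℕ} (W : E n → EReal) (μ : ProbabilityMeasure (E n)) : EReal :=
  extIntegral ((μ : Measure (E n)).prod (μ : Measure (E n))) (fun p => W (p.1 - p.2))

/-- The potential `(μ * W) x = ∫ W (x - y) dμ(y)`. -/
def potential {n : ℕ} (W : E n → EReal) (μ : ProbabilityMeasure (E n)) (x : E n) : EReal :=
  extIntegral (μ : Measure (E n)) (fun y => W (x - y))

/-- Probability measures with finite second moment and barycenter at the origin. -/
def centered (n : ℕ) : Set (ProbabilityMeasure (E n)) :=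
  {μ | Integrable (fun x : E n => ‖x‖ ^ 2) (μ : Measure (E n)) ∧
    ∫ x : E n, x ∂(μ : Measure (E n)) = 0}

/-- The centered global minimizers of the hard-confinement energy among all probability measures. -/
def hardMinimizers (n : ℕ) (β : ℝ) : Set (ProbabilityMeasure (E n)) :=
  argmin Set.univ (energy (hardConfinement β)) ∩ centered n

/-- The joint laws of pairs of random vectors with laws `μ` and `ν`. -/
def couplings {n : ℕ} (μ ν : ProbabilityMeasure (E n)) : Set (Measure (E n × E n)) :=
  {π | π.map Prod.fst = (μ : Measure (E n)) ∧ π.map Prod.snd = (ν : Measure (E n))}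

/-- The Kantorovich-Rubinstein-Wasserstein distance `d₂`: the infimum of `‖X - Y‖_{L²}` over
all couplings. -/
def d2 {n : ℕ} (μ ν : ProbabilityMeasure (E n)) : ℝ≥0∞ :=
  ⨅ π ∈ couplings μ ν, eLpNorm (fun p : E n × E n => p.1 - p.2) 2 π

/-- The `d₂`-distance from a measure to a set of measures. -/
def d2Set {n : ℕ} (μ : ProbabilityMeasure (E n)) (M : Set (ProbabilityMeasure (E n))) : ℝ≥0∞ :=
  ⨅ ν ∈ M, d2 μ ν

end MildRepulsion

end

namespace MildRepulsion

open Filter Topology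

variable {n : ℕ}

/-! As α → ∞ the power law turns into the hard confinement, whose minimizers come from a sharp
inequality. Let μ be centered with |x - y| ≤ 1 almost surely, T its variance, S the squared
Frobenius norm of its second-moment matrix. Expanding powers, ∬|x - y|² = 2T and ∬|x - y|⁴ = 2∫|x|⁴
+ 2T² + 4S, which for n ≥ 1 is at least 4T²(1 + 1/n). Fourth powers are at most squares here, so 2T
≤ n/(n+1) (`integral_prod_norm_sub_sq_le`). Equality forces all distances to be 0 or 1 and μ to be
uniform on the vertices of a unit simplex (`IsExtremal.exists_eq_uniformMeasure`). As p^β ≤ p² on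
[0, 1], these are exactly the centered hard minimizers (`mem_hardMinimizers_iff`). The same
comparison with one point frozen shows that x is a vertex once |x - y| ≤ 1 almost surely and ∫|x -
y|² dμ(y) ≥ n/(n+1) (`IsExtremal.measure_singleton_pos`).

A power-law minimizer has at most the energy of a simplex, and its potential at a minimum point is
at most its energy; for large α either bound forces the distances involved to concentrate
(`exists_forall_concentrated`). If the theorem failed, there would be α_k → ∞, minimizers μ_k,
`d2`-closest simplex measures ν_k, and minimum points x_k at distance at least r from the support of
ν_k. Along an ultrafilter μ_k tends weakly to a simplex measure and x_k to one of its vertices.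
Uniform integrability of second moments upgrades this to `d2` (`eventually_d2_le`), so d2(μ_k, ν_k)
becomes arbitrarily small. But μ_k keeps mass near that vertex, away from the support of ν_k, which
bounds this distance below (`le_d2_of_support`). -/

lemma integrable_of_continuous_of_ae_bounded {V F : Type*} [NormedAddCommGroup V] [ProperSpace V]
    [MeasurableSpace V] [OpensMeasurableSpace V] [SecondCountableTopology V]
    [NormedAddCommGroup F] {μ : Measure V} [IsFiniteMeasure μ]
    {R : ℝ} (hb : ∀ᵐ x ∂μ, ‖x‖ ≤ R) {f : V → F} (hf : Continuous f) : Integrable f μ := by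
  obtain ⟨C, hC⟩ := (isCompact_closedBall (0 : V) R).exists_bound_of_continuousOn hf.continuousOn
  refine Integrable.of_bound hf.aestronglyMeasurable C ?_
  filter_upwards [hb] with x hx
  exact hC x (by simpa using hx)

lemma ae_prod_norm_le {V : Type*} [NormedAddCommGroup V] [MeasurableSpace V]
    {μ : Measure V} [IsProbabilityMeasure μ]
    {R : ℝ} (hb : ∀ᵐ x ∂μ, ‖x‖ ≤ R) : ∀ᵐ z ∂μ.prod μ, ‖z‖ ≤ R := by
  filter_upwards [Measure.quasiMeasurePreserving_fst.ae hb,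
    Measure.quasiMeasurePreserving_snd.ae hb] with z h1 h2
  exact max_le h1 h2

lemma inner_eq_sum_coord (x y : E n) : inner ℝ x y = ∑ a, x a * y a := by
  simp [PiLp.inner_apply, mul_comm]

lemma integral_coord_eq_zero {μ : Measure (E n)} [IsFiniteMeasure μ]
    (hi : Integrable (fun x => x) μ) (h0 : ∫ x, x ∂μ = 0) (a : Fin n) :
    ∫ x : E n, x a ∂μ = 0 := by
  have := (EuclideanSpace.proj (𝕜 := ℝ) a : E n →L[ℝ] ℝ).integral_comp_comm hi
  simpa [h0] using this

lemma integral_inner_eq_zero {μ : Measure (E n)} [IsFiniteMeasure μ]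
    (hi : Integrable (fun x => x) μ) (h0 : ∫ x, x ∂μ = 0) (c : E n) :
    ∫ x : E n, inner ℝ c x ∂μ = 0 := by
  rw [integral_inner hi, h0, inner_zero_right]

/-- The matrix of second moments. -/
noncomputable def secondMoment (μ : Measure (E n)) (a b : Fin n) : ℝ := ∫ x, x a * x b ∂μ

/-- The variance, for centered measures. -/
noncomputable def traceMoment (μ : Measure (E n)) : ℝ := ∫ x, ‖x‖ ^ 2 ∂μ

/-! ### Moment identities and the sharp variance bound -/

section Moments

variable {μ : Measure (E n)} [IsProbabilityMeasure μ] {R : ℝ}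

lemma integral_norm_sub_sq (hi : Integrable (fun x : E n => x) μ)
    (hi2 : Integrable (fun x : E n => ‖x‖ ^ 2) μ) (h0 : ∫ x, x ∂μ = 0) (c : E n) :
    ∫ x, ‖c - x‖ ^ 2 ∂μ = ‖c‖ ^ 2 + traceMoment μ := by
  have h : ∀ x : E n, ‖c - x‖ ^ 2 = ‖c‖ ^ 2 + ‖x‖ ^ 2 - 2 * inner ℝ c x := by
    intro x; rw [norm_sub_sq_real]; ring
  simp_rw [h]
  have hin : Integrable (fun x : E n => inner ℝ c x) μ := hi.const_inner c
  rw [integral_sub (f := fun x : E n => ‖c‖ ^ 2 + ‖x‖ ^ 2) ((integrable_const _).add hi2)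
      (hin.const_mul 2),
    integral_add (integrable_const _) hi2, integral_const_mul, integral_inner_eq_zero hi h0]
  simp [traceMoment]

lemma traceMoment_eq_sum (hb : ∀ᵐ x ∂μ, ‖x‖ ≤ R) :
    traceMoment μ = ∑ a, secondMoment μ a a := by
  unfold traceMoment secondMoment
  rw [← integral_finsetSum]
  · congr 1; ext x
    rw [EuclideanSpace.real_norm_sq_eq]
    simp [pow_two]
  · intro a _
    exact integrable_of_continuous_of_ae_bounded hb (by fun_prop)

lemma integral_inner_sq (hb : ∀ᵐ x ∂μ, ‖x‖ ≤ R) (c : E n) :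
    ∫ x, (inner ℝ c x) ^ 2 ∂μ = ∑ a, ∑ b, c a * c b * secondMoment μ a b := by
  have h : ∀ x : E n, (inner ℝ c x) ^ 2 = ∑ a, ∑ b, c a * c b * (x a * x b) := by
    intro x
    rw [inner_eq_sum_coord, pow_two, Finset.sum_mul_sum]
    refine Finset.sum_congr rfl fun a _ => Finset.sum_congr rfl fun b _ => by ring
  simp_rw [h]
  rw [integral_finsetSum]
  · refine Finset.sum_congr rfl fun a _ => ?_
    rw [integral_finsetSum]
    · refine Finset.sum_congr rfl fun b _ => ?_
      rw [integral_const_mul]; rfl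
    · intro b _
      exact integrable_of_continuous_of_ae_bounded hb (by fun_prop)
  · intro a _
    exact integrable_of_continuous_of_ae_bounded hb (by fun_prop)

/-- Used twice: integrated in `c` it gives the double integral, and at a fixed `c` it controls the
potential of an extremal measure. The third-moment vector matters only in the second use. -/
lemma integral_norm_sub_pow_four (hb : ∀ᵐ x ∂μ, ‖x‖ ≤ R) (h0 : ∫ x, x ∂μ = 0) (c : E n) :
    ∫ x, ‖c - x‖ ^ 4 ∂μ = ‖c‖ ^ 4 + 2 * ‖c‖ ^ 2 * traceMoment μ + ∫ x, ‖x‖ ^ 4 ∂μ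
      + 4 * ∑ a, ∑ b, c a * c b * secondMoment μ a b
      - 4 * inner ℝ c (∫ x : E n, ‖x‖ ^ 2 • x ∂μ) := by
  have h : ∀ x : E n, ‖c - x‖ ^ 4 = ‖c‖ ^ 4 + 2 * ‖c‖ ^ 2 * ‖x‖ ^ 2 + ‖x‖ ^ 4
      + 4 * (inner ℝ c x) ^ 2 - 4 * inner ℝ c (‖x‖ ^ 2 • x) - 4 * ‖c‖ ^ 2 * inner ℝ c x := by
    intro x
    have : ‖c - x‖ ^ 4 = (‖c - x‖ ^ 2) ^ 2 := by ring
    rw [this, norm_sub_sq_real, inner_smul_right]; ring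
  simp_rw [h]
  have I : ∀ {f : E n → ℝ}, Continuous f → Integrable f μ :=
    fun hf => integrable_of_continuous_of_ae_bounded hb hf
  have Iv : ∀ {f : E n → E n}, Continuous f → Integrable f μ :=
    fun hf => integrable_of_continuous_of_ae_bounded hb hf
  rw [integral_sub (I (by fun_prop)) (I (by fun_prop)),
    integral_sub (I (by fun_prop)) (I (by fun_prop)),
    integral_add (I (by fun_prop)) (I (by fun_prop)),
    integral_add (I (by fun_prop)) (I (by fun_prop)),
    integral_add (I (by fun_prop)) (I (by fun_prop)),
    integral_const_mul, integral_const_mul, integral_const_mul, integral_const_mul,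
    integral_inner_eq_zero (Iv (by fun_prop)) h0, integral_inner_sq hb,
    integral_inner (Iv (by fun_prop))]
  simp [traceMoment]

lemma integral_prod_norm_sub_sq (hb : ∀ᵐ x ∂μ, ‖x‖ ≤ R) (h0 : ∫ x, x ∂μ = 0) :
    ∫ z, ‖z.1 - z.2‖ ^ 2 ∂(μ.prod μ) = 2 * traceMoment μ := by
  have I : ∀ {F : Type} [NormedAddCommGroup F] {f : E n → F}, Continuous f → Integrable f μ :=
    fun hf => integrable_of_continuous_of_ae_bounded hb hf
  rw [integral_prod _ (integrable_of_continuous_of_ae_bounded (ae_prod_norm_le hb) (by fun_prop))]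
  simp only [integral_norm_sub_sq (I continuous_id') (I (by fun_prop)) h0]
  rw [integral_add (I (by fun_prop)) (integrable_const _)]
  simp only [integral_const, probReal_univ, smul_eq_mul, one_mul]
  simp only [traceMoment]; ring

lemma integral_prod_norm_sub_pow_four (hb : ∀ᵐ x ∂μ, ‖x‖ ≤ R) (h0 : ∫ x, x ∂μ = 0) :
    ∫ z, ‖z.1 - z.2‖ ^ 4 ∂(μ.prod μ) = 2 * ∫ x, ‖x‖ ^ 4 ∂μ + 2 * traceMoment μ ^ 2
      + 4 * ∑ a, ∑ b, secondMoment μ a b ^ 2 := by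
  have I : ∀ {F : Type} [NormedAddCommGroup F] {f : E n → F}, Continuous f → Integrable f μ :=
    fun hf => integrable_of_continuous_of_ae_bounded hb hf
  rw [integral_prod _ (integrable_of_continuous_of_ae_bounded (ae_prod_norm_le hb) (by fun_prop))]
  simp only [integral_norm_sub_pow_four hb h0]
  have h1 : ∫ x : E n, inner ℝ x (∫ x : E n, ‖x‖ ^ 2 • x ∂μ) ∂μ = 0 := by
    rw [← integral_inner_eq_zero (I continuous_id') h0 (∫ x : E n, ‖x‖ ^ 2 • x ∂μ)]
    exact integral_congr_ae (ae_of_all _ fun x => real_inner_comm _ _)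
  have h2 : ∫ x : E n, ∑ a, ∑ b, x a * x b * secondMoment μ a b ∂μ
      = ∑ a, ∑ b, secondMoment μ a b ^ 2 := by
    rw [integral_finsetSum _ (fun a _ => I (by fun_prop))]
    refine Finset.sum_congr rfl fun a _ => ?_
    rw [integral_finsetSum _ (fun a _ => I (by fun_prop))]
    refine Finset.sum_congr rfl fun b _ => ?_
    rw [integral_mul_const, pow_two]; rfl
  rw [integral_sub (I (by fun_prop)) (I (by fun_prop)),
    integral_add (I (by fun_prop)) (I (by fun_prop)),
    integral_add (I (by fun_prop)) (I (by fun_prop)),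
    integral_add (I (by fun_prop)) (I (by fun_prop)),
    integral_const_mul, integral_const_mul, h1, h2, integral_mul_const, integral_const_mul]
  simp only [integral_const, probReal_univ, smul_eq_mul, one_mul]
  simp only [traceMoment]; ring

/-- Distance of the second-moment matrix from its isotropic part. Keeping the exact deficit, rather
than just Cauchy-Schwarz, makes the equality case available. -/
lemma sum_secondMoment_sub_sq (hn : n ≠ 0) (hb : ∀ᵐ x ∂μ, ‖x‖ ≤ R) :
    ∑ a, ∑ b, (secondMoment μ a b - if a = b then traceMoment μ / n else 0) ^ 2
      = (∑ a, ∑ b, secondMoment μ a b ^ 2) - traceMoment μ ^ 2 / n := by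
  have hn' : (n : ℝ) ≠ 0 := by exact_mod_cast hn
  have h : ∀ a b : Fin n, (secondMoment μ a b - if a = b then traceMoment μ / n else 0) ^ 2
      = secondMoment μ a b ^ 2 - (if a = b then 2 * (traceMoment μ / n) * secondMoment μ a b
        - (traceMoment μ / n) ^ 2 else 0) := by
    intro a b; split_ifs <;> ring
  simp_rw [h, Finset.sum_sub_distrib]
  simp only [Finset.sum_ite_eq, Finset.mem_univ, if_true]
  rw [Finset.sum_sub_distrib, ← Finset.mul_sum, ← traceMoment_eq_sum hb]
  simp
  field_simp
  ring

lemma traceMoment_sq_le (hb : ∀ᵐ x ∂μ, ‖x‖ ≤ R) :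
    traceMoment μ ^ 2 ≤ n * ∑ a, ∑ b, secondMoment μ a b ^ 2 := by
  rcases eq_or_ne n 0 with hn | hn
  · subst hn
    have : traceMoment μ = 0 := by simp [traceMoment_eq_sum hb]
    simp [this]
  · have h := sum_secondMoment_sub_sq hn hb
    have hp : 0 ≤ ∑ a, ∑ b, (secondMoment μ a b - if a = b then traceMoment μ / n else 0) ^ 2 := by
      positivity
    have hn' : (0 : ℝ) < n := by exact_mod_cast Nat.pos_of_ne_zero hn
    rw [h, sub_nonneg, div_le_iff₀ hn'] at hp
    linarith

lemma integral_norm_sq_sub_traceMoment_sq (hb : ∀ᵐ x ∂μ, ‖x‖ ≤ R) :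
    ∫ x, (‖x‖ ^ 2 - traceMoment μ) ^ 2 ∂μ = (∫ x, ‖x‖ ^ 4 ∂μ) - traceMoment μ ^ 2 := by
  have I : ∀ {f : E n → ℝ}, Continuous f → Integrable f μ :=
    fun hf => integrable_of_continuous_of_ae_bounded hb hf
  have h : ∀ x : E n, (‖x‖ ^ 2 - traceMoment μ) ^ 2
      = ‖x‖ ^ 4 - 2 * traceMoment μ * ‖x‖ ^ 2 + traceMoment μ ^ 2 := by intro x; ring
  simp_rw [h]
  rw [integral_add (I (by fun_prop)) (integrable_const _),
    integral_sub (I (by fun_prop)) (I (by fun_prop)), integral_const_mul]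
  simp only [integral_const, probReal_univ, smul_eq_mul, one_mul]
  simp only [traceMoment]; ring

/-- Centering a measure does not change the law of the differences. -/
lemma integral_prod_map_sub (m : E n) (f : E n → ℝ) (hf : Continuous f) :
    ∫ z, f (z.1 - z.2) ∂((μ.map (· - m)).prod (μ.map (· - m)))
      = ∫ z, f (z.1 - z.2) ∂(μ.prod μ) := by
  have hm : Measurable (fun x : E n => x - m) := by fun_prop
  have hc : Continuous fun z : E n × E n => f (z.1 - z.2) := by fun_prop
  rw [Measure.map_prod_map _ _ hm hm, integral_map (by fun_prop) hc.aestronglyMeasurable]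
  simp

/-- After centering, compare second and fourth powers of the distance: ∫‖x‖⁴ ≥ T² by Jensen and n S
≥ T² by Cauchy-Schwarz, whence 4(n+1)T² ≤ 2nT. -/
lemma integral_prod_norm_sub_sq_le (h1 : ∀ᵐ z ∂μ.prod μ, ‖z.1 - z.2‖ ≤ 1) :
    ∫ z, ‖z.1 - z.2‖ ^ 2 ∂(μ.prod μ) ≤ n / (n + 1) := by
  obtain ⟨x₀, hx₀⟩ := (Measure.ae_ae_of_ae_prod h1).exists
  have hb : ∀ᵐ x ∂μ, ‖x‖ ≤ ‖x₀‖ + 1 := by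
    filter_upwards [hx₀] with y hy
    have := norm_sub_norm_le y x₀
    rw [norm_sub_rev] at this
    change ‖x₀ - y‖ ≤ 1 at hy
    linarith
  set m := ∫ x, x ∂μ
  set ν := μ.map (· - m)
  have hm : Measurable (fun x : E n => x - m) := by fun_prop
  have : IsProbabilityMeasure ν := Measure.isProbabilityMeasure_map hm.aemeasurable
  have hbν : ∀ᵐ x ∂ν, ‖x‖ ≤ ‖x₀‖ + 1 + ‖m‖ := by
    rw [ae_map_iff hm.aemeasurable (measurableSet_le (by fun_prop) (by fun_prop))]
    filter_upwards [hb] with y hy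
    exact (norm_sub_le _ _).trans (by linarith)
  have h0 : ∫ x, x ∂ν = 0 := by
    rw [integral_map (f := fun x : E n => x) hm.aemeasurable aestronglyMeasurable_id]
    rw [integral_sub (integrable_of_continuous_of_ae_bounded hb continuous_id')
      (integrable_const _)]
    simp [m]
  have e2 := integral_prod_norm_sub_sq hbν h0
  have e4 := integral_prod_norm_sub_pow_four hbν h0
  rw [integral_prod_map_sub m (fun x => ‖x‖ ^ 2) (by fun_prop)] at e2
  rw [integral_prod_map_sub m (fun x => ‖x‖ ^ 4) (by fun_prop)] at e4
  have hle : ∫ z, ‖z.1 - z.2‖ ^ 4 ∂(μ.prod μ) ≤ ∫ z, ‖z.1 - z.2‖ ^ 2 ∂(μ.prod μ) := by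
    refine integral_mono_ae
      (integrable_of_continuous_of_ae_bounded (ae_prod_norm_le hb) (by fun_prop))
      (integrable_of_continuous_of_ae_bounded (ae_prod_norm_le hb) (by fun_prop)) ?_
    filter_upwards [h1] with z hz
    exact pow_le_pow_of_le_one (norm_nonneg _) hz (by norm_num)
  have hM := traceMoment_sq_le hbν
  have hv := integral_norm_sq_sub_traceMoment_sq hbν
  have hv0 : 0 ≤ ∫ x, (‖x‖ ^ 2 - traceMoment ν) ^ 2 ∂ν := integral_nonneg fun x => by positivity
  have hT : 0 ≤ traceMoment ν := integral_nonneg fun x => by positivity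
  rw [e2]
  rw [le_div_iff₀ (by positivity)]
  -- The moment comparison yields the claim only after multiplication by the variance, so variance
  -- zero is separate.
  rcases hT.eq_or_lt with hT | hT
  · rw [← hT]; simp
  · have hn : (0 : ℝ) ≤ n := by positivity
    have : (traceMoment ν) * (2 * traceMoment ν * (n + 1)) ≤ traceMoment ν * n := by
      have h3 : (n : ℝ) * (4 * traceMoment ν ^ 2 + 4 * ∑ a, ∑ b, secondMoment ν a b ^ 2)
          ≤ n * (2 * traceMoment ν) := by
        apply mul_le_mul_of_nonneg_left _ hn
        linarith
      nlinarith
    exact le_of_mul_le_mul_left this hT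

end Moments

/-! ### The equality case -/

/-- A centered measure of diameter at most one that has maximal variance. -/
structure IsExtremal (μ : Measure (E n)) : Prop where
  ae_le_one : ∀ᵐ z ∂μ.prod μ, ‖z.1 - z.2‖ ≤ 1
  mean_eq_zero : ∫ x, x ∂μ = 0
  le_integral : (n : ℝ) / (n + 1) ≤ ∫ z, ‖z.1 - z.2‖ ^ 2 ∂(μ.prod μ)

lemma exists_ae_norm_le {μ : Measure (E n)} [IsProbabilityMeasure μ]
    (h1 : ∀ᵐ z ∂μ.prod μ, ‖z.1 - z.2‖ ≤ 1) : ∃ R : ℝ, ∀ᵐ x ∂μ, ‖x‖ ≤ R := by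
  obtain ⟨x₀, hx₀⟩ := (Measure.ae_ae_of_ae_prod h1).exists
  refine ⟨‖x₀‖ + 1, ?_⟩
  filter_upwards [hx₀] with y hy
  have := norm_sub_norm_le y x₀
  rw [norm_sub_rev] at this
  change ‖x₀ - y‖ ≤ 1 at hy
  linarith

lemma eq_zero_or_eq_one_of_sq_eq_pow_four {p : ℝ} (hp : 0 ≤ p) (h : p ^ 2 = p ^ 4) :
    p = 0 ∨ p = 1 := by
  have h' : p ^ 2 * ((p - 1) * (p + 1)) = 0 := by ring_nf; linarith
  rcases mul_eq_zero.1 h' with h0 | h0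
  · exact Or.inl (pow_eq_zero_iff (by norm_num) |>.1 h0)
  · rcases mul_eq_zero.1 h0 with h1 | h1
    · right; linarith
    · linarith

namespace IsExtremal

variable {μ : Measure (E n)} [IsProbabilityMeasure μ]

lemma traceMoment_eq (h : IsExtremal μ) : traceMoment μ = n / (2 * (n + 1)) := by
  obtain ⟨R, hb⟩ := exists_ae_norm_le h.ae_le_one
  have e := integral_prod_norm_sub_sq hb h.mean_eq_zero
  have h3 := h.le_integral
  have h4 := integral_prod_norm_sub_sq_le h.ae_le_one
  have : 2 * traceMoment μ = n / (n + 1) := by linarith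
  have hn : (n : ℝ) + 1 ≠ 0 := by positivity
  field_simp at this ⊢
  linarith

/-- Equality in the variance bound makes each of its three ingredients an equality: Jensen,
Cauchy-Schwarz, and the comparison of fourth with second powers. -/
lemma moments (h : IsExtremal μ) (hn : n ≠ 0) :
    (∫ x, ‖x‖ ^ 4 ∂μ = traceMoment μ ^ 2) ∧
    (n * ∑ a, ∑ b, secondMoment μ a b ^ 2 = traceMoment μ ^ 2) ∧
    ∫ z, ‖z.1 - z.2‖ ^ 4 ∂(μ.prod μ) = ∫ z, ‖z.1 - z.2‖ ^ 2 ∂(μ.prod μ) := by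
  obtain ⟨R, hb⟩ := exists_ae_norm_le h.ae_le_one
  have e2 := integral_prod_norm_sub_sq hb h.mean_eq_zero
  have e4 := integral_prod_norm_sub_pow_four hb h.mean_eq_zero
  have hle : ∫ z, ‖z.1 - z.2‖ ^ 4 ∂(μ.prod μ) ≤ ∫ z, ‖z.1 - z.2‖ ^ 2 ∂(μ.prod μ) := by
    refine integral_mono_ae
      (integrable_of_continuous_of_ae_bounded (ae_prod_norm_le hb) (by fun_prop))
      (integrable_of_continuous_of_ae_bounded (ae_prod_norm_le hb) (by fun_prop)) ?_
    filter_upwards [h.ae_le_one] with z hz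
    exact pow_le_pow_of_le_one (norm_nonneg _) hz (by norm_num)
  have hM := traceMoment_sq_le hb
  have hv := integral_norm_sq_sub_traceMoment_sq hb
  have hv0 : 0 ≤ ∫ x, (‖x‖ ^ 2 - traceMoment μ) ^ 2 ∂μ := integral_nonneg fun x => by positivity
  have hT : 2 * (n + 1) * traceMoment μ = n := by
    rw [h.traceMoment_eq]; field_simp
  have hn' : (0 : ℝ) < n := by exact_mod_cast Nat.pos_of_ne_zero hn
  rw [e4, e2] at hle
  rw [e4, e2]
  rw [hv] at hv0
  set Q := ∫ x, ‖x‖ ^ 4 ∂μ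
  set T := traceMoment μ
  set S := ∑ a, ∑ b, secondMoment μ a b ^ 2
  have k0 : 2 * (n + 1) * T * T = n * T := by rw [hT]
  have k1 : (n : ℝ) * (2 * Q + 2 * T ^ 2 + 4 * S) ≤ n * (2 * T) :=
    mul_le_mul_of_nonneg_left hle hn'.le
  have k2 : 0 ≤ (n : ℝ) * (Q - T ^ 2) := mul_nonneg hn'.le hv0
  have k3 : (n : ℝ) * (Q - T ^ 2) = 0 := by nlinarith
  have k4 : Q = T ^ 2 := by
    rcases mul_eq_zero.1 k3 with h | h <;> linarith
  have k5 : n * S = T ^ 2 := by nlinarith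
  refine ⟨k4, k5, ?_⟩
  have : (n : ℝ) * (2 * Q + 2 * T ^ 2 + 4 * S) = n * (2 * T) := by
    rw [k4]; nlinarith
  exact mul_left_cancel₀ hn'.ne' this

lemma ae_norm_sq (h : IsExtremal μ) : ∀ᵐ x ∂μ, ‖x‖ ^ 2 = traceMoment μ := by
  rcases eq_or_ne n 0 with hn | hn
  · subst hn
    refine ae_of_all _ fun x => ?_
    simp [h.traceMoment_eq, Subsingleton.elim x 0]
  obtain ⟨R, hb⟩ := exists_ae_norm_le h.ae_le_one
  have hv := integral_norm_sq_sub_traceMoment_sq hb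
  rw [(h.moments hn).1, sub_self, integral_eq_zero_iff_of_nonneg (fun x => by positivity)
    (integrable_of_continuous_of_ae_bounded hb (by fun_prop))] at hv
  filter_upwards [hv] with x hx
  have := pow_eq_zero_iff (by norm_num) |>.1 hx
  linarith

lemma secondMoment_eq (h : IsExtremal μ) (a b : Fin n) :
    secondMoment μ a b = if a = b then traceMoment μ / n else 0 := by
  have hn : n ≠ 0 := by rintro rfl; exact a.elim0
  obtain ⟨R, hb⟩ := exists_ae_norm_le h.ae_le_one
  have hs := sum_secondMoment_sub_sq hn hb
  have hn' : (n : ℝ) ≠ 0 := by exact_mod_cast hn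
  rw [← (h.moments hn).2.1, mul_div_cancel_left₀ _ hn', sub_self,
    Finset.sum_eq_zero_iff_of_nonneg (fun _ _ => by positivity)] at hs
  have hs' := hs a (Finset.mem_univ _)
  rw [Finset.sum_eq_zero_iff_of_nonneg (fun _ _ => by positivity)] at hs'
  have := pow_eq_zero_iff (by norm_num) |>.1 (hs' b (Finset.mem_univ _))
  linarith

lemma ae_zero_or_one (h : IsExtremal μ) :
    ∀ᵐ z ∂μ.prod μ, ‖z.1 - z.2‖ = 0 ∨ ‖z.1 - z.2‖ = 1 := by
  rcases eq_or_ne n 0 with hn | hn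
  · subst hn
    exact ae_of_all _ fun z => Or.inl (by simp [Subsingleton.elim z.1 z.2])
  obtain ⟨R, hb⟩ := exists_ae_norm_le h.ae_le_one
  have hI : ∀ {f : E n × E n → ℝ}, Continuous f → Integrable f (μ.prod μ) :=
    fun hf => integrable_of_continuous_of_ae_bounded (ae_prod_norm_le hb) hf
  have h0 : ∫ z, (‖z.1 - z.2‖ ^ 2 - ‖z.1 - z.2‖ ^ 4) ∂(μ.prod μ) = 0 := by
    rw [integral_sub (hI (by fun_prop)) (hI (by fun_prop)), (h.moments hn).2.2, sub_self]
  rw [integral_eq_zero_iff_of_nonneg_ae _ (hI (by fun_prop))] at h0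
  · filter_upwards [h0] with z hz
    exact eq_zero_or_eq_one_of_sq_eq_pow_four (norm_nonneg _) (sub_eq_zero.1 hz)
  · filter_upwards [h.ae_le_one] with z hz
    exact sub_nonneg.2 (pow_le_pow_of_le_one (norm_nonneg _) hz (by norm_num))

lemma integral_norm_sub_sq_eq (h : IsExtremal μ) (x : E n) :
    ∫ y, ‖x - y‖ ^ 2 ∂μ = ‖x‖ ^ 2 + traceMoment μ := by
  obtain ⟨R, hb⟩ := exists_ae_norm_le h.ae_le_one
  exact integral_norm_sub_sq (integrable_of_continuous_of_ae_bounded hb continuous_id')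
    (integrable_of_continuous_of_ae_bounded hb (by fun_prop)) h.mean_eq_zero x

/-- With distances 0 or 1 the squared distance is the indicator of the complement of `{x}`. -/
lemma integral_eq_one_sub_measureReal {x : E n}
    (hx : ∀ᵐ y ∂μ, ‖x - y‖ = 0 ∨ ‖x - y‖ = 1) :
    ∫ y, ‖x - y‖ ^ 2 ∂μ = 1 - μ.real {x} := by
  have e : (fun y => ‖x - y‖ ^ 2) =ᵐ[μ] ({x}ᶜ : Set (E n)).indicator 1 := by
    filter_upwards [hx] with y hy
    by_cases hxy : y = x
    · simp [hxy]
    · have : ‖x - y‖ ≠ 0 := norm_ne_zero_iff.2 (sub_ne_zero.2 (Ne.symm hxy))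
      simp [hxy, hy.resolve_left this]
  rw [integral_congr_ae e, integral_indicator_one (measurableSet_singleton x).compl,
    probReal_compl_eq_one_sub (measurableSet_singleton x)]

lemma ae_measureReal_singleton (h : IsExtremal μ) :
    ∀ᵐ x ∂μ, μ.real {x} = 1 / (n + 1) := by
  filter_upwards [h.ae_norm_sq, Measure.ae_ae_of_ae_prod h.ae_zero_or_one] with x hx hy
  have h1 := integral_eq_one_sub_measureReal hy
  rw [h.integral_norm_sub_sq_eq, hx, h.traceMoment_eq] at h1
  have hn : (n : ℝ) + 1 ≠ 0 := by positivity
  field_simp at h1 ⊢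
  linarith

/-- A point that is a minimizer of the hard-confinement potential of an extremal measure is an atom
of this measure. -/
lemma measure_singleton_pos (h : IsExtremal μ) {x : E n} (hx : ∀ᵐ y ∂μ, ‖x - y‖ ≤ 1)
    (hi : (n : ℝ) / (n + 1) ≤ ∫ y, ‖x - y‖ ^ 2 ∂μ) : 0 < μ {x} := by
  rcases eq_or_ne n 0 with hn | hn
  · subst hn
    have : ({x} : Set (E 0)) = Set.univ := Set.eq_univ_of_forall fun y => Subsingleton.elim y x
    rw [this]; simp
  obtain ⟨R, hb⟩ := exists_ae_norm_le h.ae_le_one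
  have I : ∀ {f : E n → ℝ}, Continuous f → Integrable f μ :=
    fun hf => integrable_of_continuous_of_ae_bounded hb hf
  have hn' : (0 : ℝ) < n := by exact_mod_cast Nat.pos_of_ne_zero hn
  have hA := h.integral_norm_sub_sq_eq x
  have hB := integral_norm_sub_pow_four hb h.mean_eq_zero x
  have hu : ∫ y : E n, ‖y‖ ^ 2 • y ∂μ = 0 := by
    have : (fun y : E n => ‖y‖ ^ 2 • y) =ᵐ[μ] fun y => traceMoment μ • y := by
      filter_upwards [h.ae_norm_sq] with y hy
      rw [hy]
    rw [integral_congr_ae this, integral_smul, h.mean_eq_zero, smul_zero]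
  have hS : ∑ a, ∑ b, x a * x b * secondMoment μ a b = ‖x‖ ^ 2 * (traceMoment μ / n) := by
    simp only [h.secondMoment_eq, mul_ite, mul_zero, Finset.sum_ite_eq, Finset.mem_univ, if_true]
    rw [← Finset.sum_mul, EuclideanSpace.real_norm_sq_eq]
    simp [pow_two]
  rw [hu, inner_zero_right, hS, (h.moments hn).1] at hB
  have hT : 2 * (n + 1) * traceMoment μ = n := by
    rw [h.traceMoment_eq]; field_simp
  have hle : ∀ᵐ y ∂μ, ‖x - y‖ ^ 4 ≤ ‖x - y‖ ^ 2 := by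
    filter_upwards [hx] with y hy
    exact pow_le_pow_of_le_one (norm_nonneg _) hy (by norm_num)
  have hBA : ∫ y, ‖x - y‖ ^ 4 ∂μ ≤ ∫ y, ‖x - y‖ ^ 2 ∂μ :=
    integral_mono_ae (I (by fun_prop)) (I (by fun_prop)) hle
  have hsT : (traceMoment μ) / n = 1 / (2 * (n + 1)) := by
    rw [h.traceMoment_eq]; field_simp
  rw [hsT] at hB
  set T := traceMoment μ
  set s := ‖x‖ ^ 2
  have hs4 : ‖x‖ ^ 4 = s ^ 2 := by simp only [s]; ring
  rw [hs4] at hB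
  have h2T : (n : ℝ) / (n + 1) = 2 * T := by
    rw [div_eq_iff (by positivity)]; linarith
  have h2T' : 2 * T = 1 - 1 / (n + 1) := by
    rw [← h2T]; field_simp; ring
  -- The hypothesis `hi` gives s ≥ T. The fourth moment equals (s + T)² + 2s(1 - 2T), so its
  -- comparison with s + T reads (s - T)(1 + (s - T)) ≤ 0.
  have hs : s = T := by
    rw [hA, h2T] at hi
    have hq : 1 / (2 * ((n : ℝ) + 1)) = (1 - 2 * T) / 2 := by rw [h2T']; field_simp; ring
    rw [hA, hB, hq] at hBA
    have : (s - T) * (1 + (s - T)) ≤ 0 := by nlinarith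
    by_contra hne
    have : 0 < s - T := lt_of_le_of_ne (by linarith) (fun h => hne (by linarith))
    nlinarith
  have hAB : ∫ y, (‖x - y‖ ^ 2 - ‖x - y‖ ^ 4) ∂μ = 0 := by
    rw [integral_sub (I (by fun_prop)) (I (by fun_prop)), hA, hB, hs]
    have hq : 1 / (2 * ((n : ℝ) + 1)) = (1 - 2 * T) / 2 := by rw [h2T']; field_simp; ring
    rw [hq]; ring
  rw [integral_eq_zero_iff_of_nonneg_ae _ (I (by fun_prop))] at hAB
  · have h01 : ∀ᵐ y ∂μ, ‖x - y‖ = 0 ∨ ‖x - y‖ = 1 := by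
      filter_upwards [hAB] with y hy
      exact eq_zero_or_eq_one_of_sq_eq_pow_four (norm_nonneg _) (sub_eq_zero.1 hy)
    have h1 := integral_eq_one_sub_measureReal h01
    rw [hA, hs] at h1
    have h2 : 0 < 1 / ((n : ℝ) + 1) := by positivity
    have h3 : μ.real {x} ≠ 0 := by
      intro h0; rw [h0] at h1; linarith
    rw [pos_iff_ne_zero]
    intro h0
    exact h3 (by simp [Measure.real, h0])
  · filter_upwards [hle] with y hy
    exact sub_nonneg.2 hy

end IsExtremal

/-! ### Extremal measures are uniform on unit simplices -/

/-- Centered regular simplices of unit side. -/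
def unitSimplices (n : ℕ) : Set (Fin (n + 1) → E n) :=
  {v | (∀ i j, i ≠ j → ‖v i - v j‖ = 1) ∧ ∑ i, v i = 0}

/-- The uniform distribution on the points of a tuple, as a measure. -/
noncomputable def uniformMeasure (v : Fin (n + 1) → E n) : Measure (E n) :=
  ∑ i, ((n : ℝ≥0∞) + 1)⁻¹ • Measure.dirac (v i)

/-- Almost every point is an atom of mass 1/(n+1), so there are exactly n + 1 atoms. Pairs of
distinct atoms have positive product mass, so the almost sure alternative "0 or 1" holds for them
and gives distance 1. -/
lemma IsExtremal.exists_eq_uniformMeasure {μ : Measure (E n)} [IsProbabilityMeasure μ]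
    (h : IsExtremal μ) : ∃ v ∈ unitSimplices n, μ = uniformMeasure v := by
  set A : Set (E n) := {x | μ.real {x} = 1 / (n + 1)} with hA
  have hAae : ∀ᵐ x ∂μ, x ∈ A := h.ae_measureReal_singleton
  have hcard : ∀ F : Finset (E n), (F : Set (E n)) ⊆ A → μ.real F = F.card / (n + 1) := by
    intro F hF
    rw [← sum_measureReal_singleton]
    rw [Finset.sum_congr rfl (fun x hx => (hF hx : μ.real {x} = 1 / (n + 1)))]
    simp [div_eq_mul_inv]
  have hle : ∀ F : Finset (E n), (F : Set (E n)) ⊆ A → F.card ≤ n + 1 := by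
    intro F hF
    have h1 := hcard F hF
    have h2 : μ.real (F : Set (E n)) ≤ 1 := measureReal_le_one
    rw [h1, div_le_one (by positivity)] at h2
    exact_mod_cast h2
  have hfin : A.Finite := by
    by_contra hinf
    obtain ⟨F, hF, hc⟩ := Set.Infinite.exists_subset_card_eq hinf (n + 2)
    have := hle F hF
    omega
  set F := hfin.toFinset
  have hFA : (F : Set (E n)) = A := hfin.coe_toFinset
  have hFc : F.card = n + 1 := by
    have h1 := hcard F hFA.subset
    have h2 : μ.real (F : Set (E n)) = 1 := by
      rw [hFA, Measure.real, (prob_compl_eq_zero_iff hfin.measurableSet).1 hAae]; simp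
    rw [h2, eq_div_iff (by positivity), one_mul] at h1
    exact_mod_cast h1.symm
  set e : Fin (n + 1) ≃ F := (Finset.equivFinOfCardEq hFc).symm
  have hemem : ∀ i, (e i : E n) ∈ A := fun i => hFA ▸ (e i).2
  have hμ : μ = uniformMeasure fun i => (e i : E n) := by
    ext s hs
    have hres : μ s = μ (s ∩ F) := by
      rw [hFA]
      refine measure_congr ?_
      filter_upwards [hAae] with x hx
      exact propext ⟨fun h => ⟨h, hx⟩, fun h => h.1⟩
    classical
    have hsing : ∀ x ∈ F, μ {x} = ((n : ℝ≥0∞) + 1)⁻¹ := by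
      intro x hx
      have hx' : μ.real {x} = 1 / (n + 1) := hFA.subset hx
      rw [← ofReal_measureReal, hx', one_div, ENNReal.ofReal_inv_of_pos (by positivity)]
      congr 1
      rw [ENNReal.ofReal_add (by positivity) (by norm_num)]; simp
    have hsF : s ∩ F = ((F.filter (· ∈ s) : Finset (E n)) : Set (E n)) := by
      ext x; simp [and_comm]
    rw [hres, hsF, ← sum_measure_singleton, Finset.sum_filter]
    simp only [uniformMeasure, Measure.coe_finsetSum, Finset.sum_apply, Measure.smul_apply,
      Measure.dirac_apply' _ hs, smul_eq_mul]
    rw [← Finset.sum_coe_sort F, ← e.sum_comp]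
    refine Finset.sum_congr rfl fun i _ => ?_
    rw [hsing _ (e i).2]
    by_cases hi : (e i : E n) ∈ s <;> simp [hi]
  refine ⟨fun i => (e i : E n), ⟨?_, ?_⟩, hμ⟩
  · intro i j hij
    have hne : (e i : E n) ≠ e j := fun h => hij (e.injective (Subtype.ext h))
    have hpos : μ.prod μ {((e i : E n), (e j : E n))} ≠ 0 := by
      rw [← Set.singleton_prod_singleton, Measure.prod_prod]
      have hp : ∀ k, μ {(e k : E n)} ≠ 0 := by
        intro k hk
        have : μ.real {(e k : E n)} = 1 / (n + 1) := hemem k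
        rw [Measure.real, hk, ENNReal.toReal_zero] at this
        have hpos : (0 : ℝ) < 1 / (n + 1) := by positivity
        exact hpos.ne this
      exact mul_ne_zero (hp i) (hp j)
    by_contra hd
    apply hpos
    refine measure_mono_null ?_ h.ae_zero_or_one
    rintro z rfl
    simp only [Set.mem_compl_iff, Set.mem_ofPred_eq]
    rintro (h0 | h0)
    · exact hne (sub_eq_zero.1 (norm_eq_zero.1 h0))
    · exact hd h0
  · have h0 := h.mean_eq_zero
    rw [hμ, uniformMeasure, integral_finsetSum_measure] at h0
    · simp only [integral_smul_measure, integral_dirac] at h0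
      rw [← Finset.smul_sum] at h0
      refine (smul_eq_zero.1 h0).resolve_left ?_
      refine ENNReal.toReal_ne_zero.2 ⟨?_, ?_⟩ <;> simp
    · intro i _
      exact (integrable_dirac (by simp)).smul_measure (by simp)

/-! ### Extended-valued integrals -/

section ExtIntegral

variable {X : Type*} [MeasurableSpace X] {μ : Measure X}

lemma extIntegral_congr_ae {f g : X → EReal} (h : f =ᵐ[μ] g) :
    extIntegral μ f = extIntegral μ g := by
  unfold extIntegral
  have h1 : ∫⁻ x, (f x).toENNReal ∂μ = ∫⁻ x, (g x).toENNReal ∂μ :=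
    lintegral_congr_ae (h.fun_comp EReal.toENNReal)
  have h2 : ∫⁻ x, (-f x).toENNReal ∂μ = ∫⁻ x, (-g x).toENNReal ∂μ :=
    lintegral_congr_ae (h.fun_comp fun x => (-x).toENNReal)
  rw [h1, h2]

lemma extIntegral_coe (f : X → ℝ) : extIntegral μ (fun x => (f x : EReal))
    = ((∫⁻ x, ENNReal.ofReal (f x) ∂μ : ℝ≥0∞) : EReal)
      - ((∫⁻ x, ENNReal.ofReal (-f x) ∂μ : ℝ≥0∞) : EReal) := by
  simp only [extIntegral, ← EReal.coe_neg, EReal.real_coe_toENNReal]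

lemma extIntegral_coe_of_integrable {f : X → ℝ} (hf : Integrable f μ) :
    extIntegral μ (fun x => (f x : EReal)) = ((∫ x, f x ∂μ : ℝ) : EReal) := by
  rw [extIntegral_coe, integral_eq_lintegral_pos_part_sub_lintegral_neg_part hf, EReal.coe_sub,
    EReal.coe_ennreal_toReal hf.lintegral_lt_top.ne,
    EReal.coe_ennreal_toReal (by simpa using hf.neg.lintegral_lt_top.ne)]

lemma extIntegral_eq_top {f : X → EReal} (h1 : ∫⁻ x, (f x).toENNReal ∂μ = ⊤)
    (h2 : ∫⁻ x, (-f x).toENNReal ∂μ ≠ ⊤) : extIntegral μ f = ⊤ := by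
  rw [extIntegral, h1]
  exact EReal.top_sub (by simpa using h2)

/-- The negative part is bounded, so a positive part of infinite integral would make the extended
integral `⊤`. -/
lemma integrable_of_extIntegral_le [IsFiniteMeasure μ] {f : X → ℝ}
    (hm : AEStronglyMeasurable f μ) {C : ℝ} (hC : ∀ x, -C ≤ f x) {c : ℝ}
    (h : extIntegral μ (fun x => (f x : EReal)) ≤ c) : Integrable f μ ∧ ∫ x, f x ∂μ ≤ c := by
  have hneg : ∫⁻ x, ENNReal.ofReal (-f x) ∂μ ≠ ⊤ := by
    have h1 : ∫⁻ x, ENNReal.ofReal (-f x) ∂μ ≤ ∫⁻ _, ENNReal.ofReal C ∂μ :=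
      lintegral_mono fun x => ENNReal.ofReal_le_ofReal (by linarith [hC x])
    refine (h1.trans_lt ?_).ne
    rw [lintegral_const]
    exact ENNReal.mul_lt_top ENNReal.ofReal_lt_top (measure_lt_top _ _)
  have hpos : ∫⁻ x, ENNReal.ofReal (f x) ∂μ ≠ ⊤ := by
    intro htop
    rw [extIntegral_eq_top] at h
    · exact absurd (top_le_iff.1 h) (EReal.coe_ne_top c)
    · simpa only [EReal.real_coe_toENNReal] using htop
    · simpa only [← EReal.coe_neg, EReal.real_coe_toENNReal] using hneg
  have hI : Integrable f μ := by
    have h2 : Integrable (fun x => f x + C) μ := by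
      rw [← lintegral_ofReal_ne_top_iff_integrable (hm.add_const _)
        (ae_of_all _ fun x => by simpa using (by linarith [hC x] : 0 ≤ f x + C))]
      have h1 : ∫⁻ x, ENNReal.ofReal (f x + C) ∂μ
          ≤ ∫⁻ x, (ENNReal.ofReal (f x) + ENNReal.ofReal C) ∂μ :=
        lintegral_mono fun x => ENNReal.ofReal_add_le
      refine (h1.trans_lt ?_).ne
      rw [lintegral_add_right _ measurable_const, lintegral_const]
      exact ENNReal.add_lt_top.2 ⟨hpos.lt_top,
        ENNReal.mul_lt_top ENNReal.ofReal_lt_top (measure_lt_top _ _)⟩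
    refine (h2.sub (integrable_const C)).congr (ae_of_all _ fun x => ?_)
    simp
  refine ⟨hI, ?_⟩
  rw [extIntegral_coe_of_integrable hI] at h
  exact_mod_cast h

end ExtIntegral

/-! ### Uniform measures on simplices -/

section Uniform

lemma uniformMeasure_apply (v : Fin (n + 1) → E n) {s : Set (E n)} (hs : MeasurableSet s) :
    uniformMeasure v s = ((n : ℝ≥0∞) + 1)⁻¹ * ∑ i, s.indicator 1 (v i) := by
  simp [uniformMeasure, Measure.dirac_apply' _ hs, Finset.mul_sum]

instance (v : Fin (n + 1) → E n) : IsProbabilityMeasure (uniformMeasure v) := by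
  constructor
  rw [uniformMeasure_apply v MeasurableSet.univ]
  simp only [Set.indicator_univ, Pi.one_apply, Finset.sum_const, Finset.card_univ,
    Fintype.card_fin, nsmul_eq_mul, mul_one]
  push_cast
  exact ENNReal.inv_mul_cancel (by simp) (by simp)

lemma ae_uniformMeasure {v : Fin (n + 1) → E n} {p : E n → Prop} (h : ∀ i, p (v i)) :
    ∀ᵐ x ∂uniformMeasure v, p x := by
  have : uniformMeasure v (Set.range v)ᶜ = 0 := by
    rw [uniformMeasure_apply v (Set.finite_range v).measurableSet.compl]
    simp
  refine measure_mono_null ?_ this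
  intro x hx
  rintro ⟨i, rfl⟩
  exact hx (h i)

lemma integral_uniformMeasure {F : Type*} [NormedAddCommGroup F] [NormedSpace ℝ F]
    [CompleteSpace F] (v : Fin (n + 1) → E n) (f : E n → F) :
    ∫ x, f x ∂uniformMeasure v = ((n : ℝ) + 1)⁻¹ • ∑ i, f (v i) := by
  rw [uniformMeasure, integral_finsetSum_measure]
  · simp only [integral_smul_measure, integral_dirac, ← Finset.smul_sum]
    congr 1
    rw [ENNReal.toReal_inv, ENNReal.toReal_add (by simp) (by simp)]
    simp
  · intro i _
    exact (integrable_dirac (by simp)).smul_measure (by simp)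

lemma norm_le_one_of_mem_unitSimplices {v : Fin (n + 1) → E n} (hv : v ∈ unitSimplices n)
    (i : Fin (n + 1)) : ‖v i‖ ≤ 1 := by
  have h : ((n : ℝ) + 1) • v i = ∑ j, (v i - v j) := by
    rw [Finset.sum_sub_distrib, hv.2, sub_zero]
    simp only [Finset.sum_const, Finset.card_univ, Fintype.card_fin]
    rw [← Nat.cast_smul_eq_nsmul ℝ]; push_cast; rfl
  have h2 : ‖((n : ℝ) + 1) • v i‖ ≤ n + 1 := by
    rw [h]
    refine (norm_sum_le_of_le (f := fun j => v i - v j) (n := fun _ => (1 : ℝ)) _ ?_).trans ?_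
    · intro j _
      by_cases hij : i = j
      · simp [hij]
      · exact (hv.1 i j hij).le
    · simp
  rw [norm_smul, Real.norm_of_nonneg (by positivity)] at h2
  have hn : (0 : ℝ) < n + 1 := by positivity
  nlinarith

lemma isExtremal_uniformMeasure {v : Fin (n + 1) → E n} (hv : v ∈ unitSimplices n) :
    IsExtremal (uniformMeasure v) := by
  have hb : ∀ᵐ x ∂uniformMeasure v, ‖x‖ ≤ 1 :=
    ae_uniformMeasure (norm_le_one_of_mem_unitSimplices hv)
  refine ⟨?_, ?_, ?_⟩
  · have hs : MeasurableSet {z : E n × E n | ‖z.1 - z.2‖ ≤ 1} :=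
      measurableSet_le (by fun_prop) (by fun_prop)
    refine (Measure.ae_prod_mem_iff_ae_ae_mem hs).2 ?_
    refine ae_uniformMeasure fun i => ae_uniformMeasure fun j => ?_
    by_cases hij : i = j
    · simp [hij]
    · exact (hv.1 i j hij).le
  · rw [integral_uniformMeasure, hv.2, smul_zero]
  · rw [integral_prod _ (integrable_of_continuous_of_ae_bounded (ae_prod_norm_le hb)
      (by fun_prop))]
    simp only [integral_uniformMeasure]
    have h : ∀ i, ∑ j, ‖v i - v j‖ ^ 2 = n := by
      intro i
      rw [← Finset.add_sum_erase _ _ (Finset.mem_univ i)]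
      rw [Finset.sum_congr rfl (g := fun _ => (1 : ℝ))]
      · simp
      · intro j hj
        rw [hv.1 i j (Finset.ne_of_mem_erase hj).symm, one_pow]
    simp only [h, smul_eq_mul, Finset.sum_const, Finset.card_univ, Fintype.card_fin, nsmul_eq_mul]
    push_cast
    field_simp
    rfl

/-- The standard basis of ℝ^(n+1), centered and scaled by 1/√2, lies in the hyperplane orthogonal to
the all-ones vector, which is isometric to ℝⁿ. -/
lemma unitSimplices_nonempty (n : ℕ) : (unitSimplices n).Nonempty := by
  let o : EuclideanSpace ℝ (Fin (n + 1)) := WithLp.toLp 2 fun _ => 1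
  have ho : o ≠ 0 := by
    intro h
    have := congrArg (fun x : EuclideanSpace ℝ (Fin (n + 1)) => x 0) h
    simp [o] at this
  have : Fact (Module.finrank ℝ (EuclideanSpace ℝ (Fin (n + 1))) = n + 1) := ⟨by simp⟩
  let b := OrthonormalBasis.fromOrthogonalSpanSingleton (𝕜 := ℝ) n ho
  let u : Fin (n + 1) → EuclideanSpace ℝ (Fin (n + 1)) := fun i =>
    (√2)⁻¹ • (EuclideanSpace.single i (1 : ℝ) - ((n : ℝ) + 1)⁻¹ • o)
  have hn : (n : ℝ) + 1 ≠ 0 := by positivity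
  have hu : ∀ i, u i ∈ (ℝ ∙ o)ᗮ := by
    intro i
    rw [Submodule.mem_orthogonal_singleton_iff_inner_right]
    have hoo : inner ℝ o o = (n : ℝ) + 1 := by
      rw [real_inner_self_eq_norm_sq, EuclideanSpace.real_norm_sq_eq]
      simp [o]
    have hoi : inner ℝ o (EuclideanSpace.single i (1 : ℝ)) = 1 := by
      simp [o, EuclideanSpace.inner_single_right]
    simp only [u, inner_smul_right, inner_sub_right, hoo, hoi]
    field_simp
    ring
  refine ⟨fun i => b.repr ⟨u i, hu i⟩, ?_, ?_⟩
  · intro i j hij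
    rw [← map_sub, LinearIsometryEquiv.norm_map]
    change ‖u i - u j‖ = 1
    have h : u i - u j = (√2)⁻¹ • (EuclideanSpace.single i (1 : ℝ) - EuclideanSpace.single j 1) := by
      simp only [u, ← smul_sub]; congr 1; abel
    have h2 : ‖(EuclideanSpace.single i (1 : ℝ) - EuclideanSpace.single j 1)‖ = √2 := by
      rw [← sq_eq_sq₀ (norm_nonneg _) (Real.sqrt_nonneg _), norm_sub_sq_real,
        Real.sq_sqrt (by norm_num)]
      simp [EuclideanSpace.inner_single_left, hij]
      norm_num
    rw [h, norm_smul, h2, norm_inv, Real.norm_of_nonneg (Real.sqrt_nonneg _)]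
    exact inv_mul_cancel₀ (by positivity)
  · rw [← map_sum]
    have : ∑ i, (⟨u i, hu i⟩ : (ℝ ∙ o)ᗮ) = 0 := by
      ext a
      simp only [u, AddSubmonoidClass.coe_finsetSum, ← Finset.smul_sum, Finset.sum_sub_distrib]
      simp [o, Finset.sum_apply, hn]
    rw [this, map_zero]

end Uniform

/-! ### Energies and the hard-confinement minimizers -/

/-- The uniform distribution on the points of a tuple. -/
noncomputable def uniformProbability (v : Fin (n + 1) → E n) : ProbabilityMeasure (E n) :=
  ⟨uniformMeasure v, inferInstance⟩

@[simp] lemma coe_uniformProbability (v : Fin (n + 1) → E n) :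
    (uniformProbability v : Measure (E n)) = uniformMeasure v := rfl

lemma IsExtremal.mem_centered {μ : ProbabilityMeasure (E n)}
    (h : IsExtremal (μ : Measure (E n))) : μ ∈ centered n := by
  obtain ⟨R, hb⟩ := exists_ae_norm_le h.ae_le_one
  exact ⟨integrable_of_continuous_of_ae_bounded hb (by fun_prop), h.mean_eq_zero⟩

lemma IsExtremal.integral_prod_eq {μ : Measure (E n)} [IsProbabilityMeasure μ]
    (h : IsExtremal μ) : ∫ z, ‖z.1 - z.2‖ ^ 2 ∂(μ.prod μ) = n / (n + 1) :=
  le_antisymm (integral_prod_norm_sub_sq_le h.ae_le_one) h.le_integral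

/-- Distances are 0 or 1, where every positive power agrees with the square. -/
lemma IsExtremal.energy_powerLaw {μ : ProbabilityMeasure (E n)}
    (h : IsExtremal (μ : Measure (E n))) {α β : ℝ} (hα : 0 < α) (hβ : 0 < β) :
    energy (powerLaw α β) μ = (((1 / α - 1 / β) * (n / (n + 1)) : ℝ) : EReal) := by
  obtain ⟨R, hb⟩ := exists_ae_norm_le h.ae_le_one
  have e : (fun z : E n × E n => powerLaw α β (z.1 - z.2))
      =ᵐ[(μ : Measure (E n)).prod (μ : Measure (E n))]
      fun z => (((1 / α - 1 / β) * ‖z.1 - z.2‖ ^ 2 : ℝ) : EReal) := by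
    filter_upwards [h.ae_zero_or_one] with z hz
    rcases hz with hz | hz
    · simp [powerLaw, hz, Real.zero_rpow hα.ne', Real.zero_rpow hβ.ne']
    · simp [powerLaw, hz]
  rw [energy, extIntegral_congr_ae e, extIntegral_coe_of_integrable
    (integrable_of_continuous_of_ae_bounded (ae_prod_norm_le hb) (by fun_prop)),
    integral_const_mul, h.integral_prod_eq]

lemma energy_hardConfinement_eq_top {μ : ProbabilityMeasure (E n)} {β : ℝ} (hβ : 0 < β)
    (h : ¬ ∀ᵐ z ∂(μ : Measure (E n)).prod (μ : Measure (E n)), ‖z.1 - z.2‖ ≤ 1) :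
    energy (hardConfinement β) μ = ⊤ := by
  set π := (μ : Measure (E n)).prod (μ : Measure (E n))
  have hs : MeasurableSet {z : E n × E n | ‖z.1 - z.2‖ ≤ 1} :=
    measurableSet_le (by fun_prop) (by fun_prop)
  have hpos : π {z : E n × E n | ‖z.1 - z.2‖ ≤ 1}ᶜ ≠ 0 := h
  apply extIntegral_eq_top
  · rw [eq_top_iff]
    calc (⊤ : ℝ≥0∞) = ∫⁻ _ in {z : E n × E n | ‖z.1 - z.2‖ ≤ 1}ᶜ, ⊤ ∂π := by
          rw [setLIntegral_const, ENNReal.top_mul hpos]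
      _ = ∫⁻ z in {z : E n × E n | ‖z.1 - z.2‖ ≤ 1}ᶜ,
            (hardConfinement β (z.1 - z.2)).toENNReal ∂π := by
          refine setLIntegral_congr_fun hs.compl fun z hz => ?_
          have hz' : ¬ ‖z.1 - z.2‖ ≤ 1 := hz
          simp [hardConfinement, hz']
      _ ≤ _ := setLIntegral_le_lintegral _ _
  · have h1 : ∫⁻ z, (-hardConfinement β (z.1 - z.2)).toENNReal ∂π
        ≤ ∫⁻ _, ENNReal.ofReal (1 / β) ∂π := by
      refine lintegral_mono fun z => ?_
      by_cases hz : ‖z.1 - z.2‖ ≤ 1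
      · simp only [hardConfinement, hz, if_true, ← EReal.coe_neg, EReal.real_coe_toENNReal, neg_neg]
        refine ENNReal.ofReal_le_ofReal (div_le_div_of_nonneg_right ?_ hβ.le)
        exact Real.rpow_le_one (norm_nonneg _) hz hβ.le
      · simp [hardConfinement, hz]
    refine (h1.trans_lt ?_).ne
    simp

lemma energy_hardConfinement_of_ae {μ : ProbabilityMeasure (E n)} {β : ℝ} (hβ : 0 < β)
    (h : ∀ᵐ z ∂(μ : Measure (E n)).prod (μ : Measure (E n)), ‖z.1 - z.2‖ ≤ 1) :
    energy (hardConfinement β) μ = ((-((∫ z, ‖z.1 - z.2‖ ^ β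
      ∂((μ : Measure (E n)).prod (μ : Measure (E n)))) / β) : ℝ) : EReal) := by
  obtain ⟨R, hb⟩ := exists_ae_norm_le h
  have e : (fun z : E n × E n => hardConfinement β (z.1 - z.2))
      =ᵐ[(μ : Measure (E n)).prod (μ : Measure (E n))]
      fun z => ((-(‖z.1 - z.2‖ ^ β / β) : ℝ) : EReal) := by
    filter_upwards [h] with z hz
    simp [hardConfinement, hz]
  have hc : Continuous fun z : E n × E n => ‖z.1 - z.2‖ ^ β :=
    (Real.continuous_rpow_const hβ.le).comp (by fun_prop)
  rw [energy, extIntegral_congr_ae e, extIntegral_coe_of_integrable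
    (integrable_of_continuous_of_ae_bounded (ae_prod_norm_le hb) (by fun_prop)),
    integral_neg, integral_div]

lemma integral_rpow_le_integral_sq {μ : Measure (E n)} [IsProbabilityMeasure μ] {β : ℝ}
    (hβ : 2 ≤ β) (h : ∀ᵐ z ∂μ.prod μ, ‖z.1 - z.2‖ ≤ 1) :
    ∫ z, ‖z.1 - z.2‖ ^ β ∂(μ.prod μ) ≤ ∫ z, ‖z.1 - z.2‖ ^ 2 ∂(μ.prod μ) := by
  obtain ⟨R, hb⟩ := exists_ae_norm_le h
  have hc : Continuous fun z : E n × E n => ‖z.1 - z.2‖ ^ β :=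
    (Real.continuous_rpow_const (by linarith)).comp (by fun_prop)
  refine integral_mono_ae (integrable_of_continuous_of_ae_bounded (ae_prod_norm_le hb) hc)
    (integrable_of_continuous_of_ae_bounded (ae_prod_norm_le hb) (by fun_prop)) ?_
  filter_upwards [h] with z hz
  have := Real.rpow_le_rpow_of_exponent_ge' (norm_nonneg _) hz (by norm_num) hβ
  simpa using this

lemma le_energy_hardConfinement {β : ℝ} (hβ : 2 ≤ β) (μ : ProbabilityMeasure (E n)) :
    ((-((n / (n + 1)) / β) : ℝ) : EReal) ≤ energy (hardConfinement β) μ := by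
  by_cases h : ∀ᵐ z ∂(μ : Measure (E n)).prod (μ : Measure (E n)), ‖z.1 - z.2‖ ≤ 1
  · rw [energy_hardConfinement_of_ae (by linarith) h]
    have h1 := (integral_rpow_le_integral_sq hβ h).trans (integral_prod_norm_sub_sq_le h)
    refine EReal.coe_le_coe_iff.2 (neg_le_neg ?_)
    exact div_le_div_of_nonneg_right h1 (by linarith)
  · rw [energy_hardConfinement_eq_top (by linarith) h]
    exact le_top

lemma IsExtremal.energy_hardConfinement {μ : ProbabilityMeasure (E n)}
    (h : IsExtremal (μ : Measure (E n))) {β : ℝ} (hβ : 0 < β) :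
    energy (hardConfinement β) μ = ((-((n / (n + 1)) / β) : ℝ) : EReal) := by
  rw [energy_hardConfinement_of_ae hβ h.ae_le_one, ← h.integral_prod_eq]
  suffices e : ∫ z, ‖z.1 - z.2‖ ^ β ∂(μ : Measure (E n)).prod (μ : Measure (E n))
      = ∫ z, ‖z.1 - z.2‖ ^ 2 ∂(μ : Measure (E n)).prod (μ : Measure (E n)) by rw [e]
  refine integral_congr_ae ?_
  filter_upwards [h.ae_zero_or_one] with z hz
  rcases hz with hz | hz
  · simp [hz, Real.zero_rpow hβ.ne']
  · simp [hz]

/-- The centered minimizers of the hard-confinement energy are the extremal measures. -/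
lemma mem_hardMinimizers_iff {β : ℝ} (hβ : 2 ≤ β) {μ : ProbabilityMeasure (E n)} :
    μ ∈ hardMinimizers n β ↔ IsExtremal (μ : Measure (E n)) := by
  have hβ0 : 0 < β := by linarith
  constructor
  · rintro ⟨⟨-, hmin⟩, hc⟩
    obtain ⟨v, hv⟩ := unitSimplices_nonempty n
    have hle : energy (hardConfinement β) μ ≤ ((-((n / (n + 1)) / β) : ℝ) : EReal) := by
      have hex : IsExtremal (uniformProbability v : Measure (E n)) := isExtremal_uniformMeasure hv
      rw [← hex.energy_hardConfinement hβ0]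
      exact hmin (Set.mem_univ _)
    have h1 : ∀ᵐ z ∂(μ : Measure (E n)).prod (μ : Measure (E n)), ‖z.1 - z.2‖ ≤ 1 := by
      by_contra h
      rw [energy_hardConfinement_eq_top hβ0 h] at hle
      exact absurd (top_le_iff.1 hle) (EReal.coe_ne_top _)
    refine ⟨h1, hc.2, ?_⟩
    rw [energy_hardConfinement_of_ae hβ0 h1, EReal.coe_le_coe_iff, neg_le_neg_iff,
      div_le_div_iff_of_pos_right hβ0] at hle
    exact hle.trans (integral_rpow_le_integral_sq hβ h1)
  · intro h
    refine ⟨⟨Set.mem_univ _, fun ν _ => ?_⟩, h.mem_centered⟩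
    change energy _ μ ≤ energy _ ν
    rw [h.energy_hardConfinement hβ0]
    exact le_energy_hardConfinement hβ ν

lemma hardMinimizers_eq_image {β : ℝ} (hβ : 2 ≤ β) :
    hardMinimizers n β = uniformProbability '' unitSimplices n := by
  ext μ
  rw [mem_hardMinimizers_iff hβ]
  constructor
  · intro h
    obtain ⟨v, hv, e⟩ := h.exists_eq_uniformMeasure
    exact ⟨v, hv, Subtype.ext e.symm⟩
  · rintro ⟨v, hv, rfl⟩
    exact isExtremal_uniformMeasure hv

/-! ### Existence of a closest hard minimizer -/

lemma isCompact_unitSimplices (n : ℕ) : IsCompact (unitSimplices n) := by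
  refine Metric.isCompact_of_isClosed_isBounded ?_ ?_
  · have : unitSimplices n = (⋂ i, ⋂ j, ⋂ (_ : i ≠ j), {v | ‖v i - v j‖ = 1})
        ∩ {v | ∑ i, v i = 0} := by
      ext v; simp [unitSimplices]
    rw [this]
    refine IsClosed.inter (isClosed_iInter fun i => isClosed_iInter fun j => isClosed_iInter
      fun _ => isClosed_eq (by fun_prop) (by fun_prop)) (isClosed_eq (by fun_prop) (by fun_prop))
  · refine Metric.isBounded_closedBall (x := 0) (r := 1) |>.subset fun v hv => ?_
    rw [mem_closedBall_zero_iff, pi_norm_le_iff_of_nonneg zero_le_one]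
    exact norm_le_one_of_mem_unitSimplices hv

/-- A coupling with the first simplex measure is composed with the map sending each vertex `v i` to
`w i`; the triangle inequality in L² then bounds the cost. -/
lemma d2_uniformProbability_le (μ : ProbabilityMeasure (E n)) {v w : Fin (n + 1) → E n}
    (hv : v ∈ unitSimplices n) :
    d2 μ (uniformProbability w) ≤ d2 μ (uniformProbability v) + edist w v := by
  have hinj : Function.Injective v := by
    intro i j hij
    by_contra hne
    have := hv.1 i j hne
    simp [hij] at this
  simp only [d2, ENNReal.iInf_add]
  refine le_iInf₂ fun π hπ => ?_
  -- The values off the vertices do not affect the second marginal; the identity there makes `T`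
  -- measurable, since it differs from `id` on a countable set only.
  set T : E n → E n := Function.extend v w id
  have hT : Measurable T := by
    refine measurable_id.measurable_of_countable_ne ((Set.countable_range v).mono fun x hx => ?_)
    by_contra hx'
    exact hx (Function.extend_apply' _ _ _ (by simpa using hx')).symm
  have hTv : ∀ i, T (v i) = w i := fun i => hinj.extend_apply _ _ _
  have hπ' : π.map (Prod.map id T) ∈ couplings μ (uniformProbability w) := by
    constructor
    · rw [Measure.map_map measurable_fst (measurable_id.prodMap hT), ← hπ.1]
      rfl
    · rw [Measure.map_map measurable_snd (measurable_id.prodMap hT)]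
      have : (Prod.snd ∘ Prod.map id T : E n × E n → E n) = T ∘ Prod.snd := rfl
      rw [this, ← Measure.map_map hT measurable_snd, hπ.2]
      ext s hs
      rw [Measure.map_apply hT hs, coe_uniformProbability, coe_uniformProbability,
        uniformMeasure_apply v (hT hs), uniformMeasure_apply w hs]
      congr 1
      refine Finset.sum_congr rfl fun i _ => ?_
      have h : v i ∈ T ⁻¹' s ↔ w i ∈ s := by rw [Set.mem_preimage, hTv]
      by_cases hi : w i ∈ s
      · rw [Set.indicator_of_mem (h.2 hi), Set.indicator_of_mem hi]; rfl
      · rw [Set.indicator_of_notMem (fun hh => hi (h.1 hh)), Set.indicator_of_notMem hi]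
  have hprob : IsProbabilityMeasure π := by
    constructor
    have : π.map Prod.fst Set.univ = 1 := by rw [hπ.1]; simp
    rwa [Measure.map_apply measurable_fst MeasurableSet.univ] at this
  refine (iInf₂_le _ hπ').trans ?_
  have hm : Measurable fun p : E n × E n => p.1 - p.2 := by fun_prop
  rw [eLpNorm_map_measure hm.aestronglyMeasurable (measurable_id.prodMap hT).aemeasurable]
  have e : ((fun p : E n × E n => p.1 - p.2) ∘ Prod.map id T)
      = (fun p : E n × E n => p.1 - p.2) + fun p => p.2 - T p.2 := by
    ext1 p; simp
  have hm2 : Measurable fun p : E n × E n => p.2 - T p.2 :=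
    measurable_snd.sub (hT.comp measurable_snd)
  rw [e]
  refine (eLpNorm_add_le hm.aestronglyMeasurable hm2.aestronglyMeasurable (by norm_num)).trans ?_
  gcongr
  have hae : ∀ᵐ p ∂π, ‖p.2 - T p.2‖ ≤ dist w v := by
    have h1 : ∀ᵐ y ∂π.map Prod.snd, ‖y - T y‖ ≤ dist w v := by
      rw [hπ.2]
      refine ae_uniformMeasure fun i => ?_
      rw [hTv, ← dist_eq_norm, dist_comm]
      exact dist_le_pi_dist w v i
    exact ae_of_ae_map measurable_snd.aemeasurable h1
  refine (eLpNorm_le_of_ae_bound hae).trans ?_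
  simp [edist_dist]

/-- Among the hard-confinement minimizers there is one closest to a given measure. -/
lemma exists_hardMinimizer_closest {β : ℝ} (hβ : 2 ≤ β) (μ : ProbabilityMeasure (E n)) :
    ∃ ν ∈ hardMinimizers n β, d2 μ ν = d2Set μ (hardMinimizers n β) := by
  rw [hardMinimizers_eq_image hβ]
  have hcont : ContinuousOn (fun v => d2 μ (uniformProbability v)) (unitSimplices n) := by
    rw [continuousOn_iff_continuous_domRestrict]
    refine continuous_of_le_add_edist 1 (by simp) fun w v => ?_
    rw [one_mul]
    exact d2_uniformProbability_le μ v.2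
  obtain ⟨v, hv, hmin⟩ :=
    (isCompact_unitSimplices n).exists_isMinOn (unitSimplices_nonempty n) hcont
  refine ⟨uniformProbability v, Set.mem_image_of_mem _ hv, le_antisymm ?_ ?_⟩
  · refine le_iInf₂ fun ν hν => ?_
    obtain ⟨w, hw, rfl⟩ := hν
    exact hmin hw
  · exact iInf₂_le _ (Set.mem_image_of_mem _ hv)

/-! ### The power-law profile for large exponents -/

/-- The real-valued profile of the power-law potential. -/
noncomputable def powerProfile (α β p : ℝ) : ℝ := p ^ α / α - p ^ β / β

/-- Weighted AM-GM for p^α and 1 with weights β/α and 1 - β/α; the bound is the value of the profile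
at p = 1. -/
lemma one_div_sub_one_div_le_powerProfile {α β p : ℝ} (hβ : 0 < β) (hαβ : β ≤ α) (hp : 0 ≤ p) :
    1 / α - 1 / β ≤ powerProfile α β p := by
  have hα : 0 < α := hβ.trans_le hαβ
  have h := Real.geom_mean_le_arith_mean2_weighted (w₁ := β / α) (w₂ := 1 - β / α)
    (p₁ := p ^ α) (p₂ := 1) (by positivity) (by rw [sub_nonneg, div_le_one hα]; exact hαβ)
    (by positivity) zero_le_one (by ring)
  rw [Real.one_rpow, mul_one, ← Real.rpow_mul hp, mul_div_cancel₀ _ hα.ne'] at h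
  have h2 : p ^ β / β ≤ (β / α * p ^ α + (1 - β / α) * 1) / β := by gcongr
  have h3 : (β / α * p ^ α + (1 - β / α) * 1) / β = p ^ α / α + 1 / β - 1 / α := by
    field_simp
    ring
  unfold powerProfile
  linarith

/-- For p ≥ 1 + ε the factor p^(α-β) is exponentially large in α and beats α(N + 1). -/
lemma mul_le_powerProfile {α β ε N p : ℝ} (hβ : 2 ≤ β) (hε : 0 < ε)
    (h1 : 2 * β ≤ α) (h2 : 8 * (N + 1) / Real.log (1 + ε) ^ 2 ≤ α) (hp : 1 + ε ≤ p) :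
    N * p ^ β ≤ powerProfile α β p := by
  have hα : 0 < α := by linarith
  have hp0 : 0 < p := by linarith
  set L := Real.log (1 + ε)
  have hL : 0 < L := Real.log_pos (by linarith)
  have k1 : α * (N + 1) ≤ p ^ (α - β) := by
    have e1 : (1 + ε) ^ (α - β) ≤ p ^ (α - β) :=
      Real.rpow_le_rpow (by linarith) hp (by linarith)
    refine le_trans ?_ e1
    rw [Real.rpow_def_of_pos (by linarith)]
    have hy : 0 ≤ L * (α - β) := mul_nonneg hL.le (by linarith)
    -- Since α - β ≥ α/2, the quadratic term of exp is at least (Lα/2)²/2 = L²α²/8, the source of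
    -- the 8 in the threshold.
    have e2 := Real.quadratic_le_exp_of_nonneg hy
    have e3 : L * (α / 2) ≤ L * (α - β) := mul_le_mul_of_nonneg_left (by linarith) hL.le
    have e4 : (L * (α / 2)) ^ 2 ≤ (L * (α - β)) ^ 2 := pow_le_pow_left₀ (by positivity) e3 2
    rw [div_le_iff₀ (by positivity)] at h2
    have e5 : α * (8 * (N + 1)) ≤ α * (α * L ^ 2) := mul_le_mul_of_nonneg_left h2 hα.le
    nlinarith
  have k2 : p ^ α = p ^ (α - β) * p ^ β := by
    rw [← Real.rpow_add hp0]; congr 1; ring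
  have hpβ : 0 ≤ p ^ β := by positivity
  have k3 : (N + 1) * p ^ β ≤ p ^ α / α := by
    rw [le_div_iff₀ hα, k2]
    have := mul_le_mul_of_nonneg_right k1 hpβ
    linarith
  have k4 : p ^ β / β ≤ p ^ β := div_le_self hpβ (by linarith)
  unfold powerProfile
  linarith

/-- The part of `p ^ 2` where `p` exceeds one by a definite amount. -/
noncomputable def tailSq (η p : ℝ) : ℝ := if 1 + η ≤ p then p ^ 2 else 0

lemma tailSq_nonneg (η p : ℝ) : 0 ≤ tailSq η p := by
  unfold tailSq; split_ifs <;> positivity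

lemma measurable_tailSq (η : ℝ) : Measurable (tailSq η) :=
  Measurable.ite measurableSet_Ici (by fun_prop) measurable_const

/-- Concentration of the sublevel sets of the power-law energy for large exponents. -/
lemma exists_forall_powerProfile_concentration {β : ℝ} (hβ : 2 ≤ β) {η : ℝ} (hη : 0 < η) :
    ∃ α₁ : ℝ, 2 * β ≤ α₁ ∧ ∀ α, α₁ ≤ α → ∀ {X : Type} [MeasurableSpace X] (π : Measure X)
      [IsProbabilityMeasure π] (p : X → ℝ), Measurable p → (∀ x, 0 ≤ p x) →
      ∀ κ : ℝ, 0 ≤ κ → κ ≤ 1 →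
      extIntegral π (fun x => (powerProfile α β (p x) : EReal))
        ≤ (((1 / α - 1 / β) * κ : ℝ) : EReal) →
      Integrable (fun x => tailSq η (p x)) π ∧ ∫ x, tailSq η (p x) ∂π ≤ η ∧
        κ - η ≤ ∫ x, min (p x) 1 ^ 2 ∂π := by
  have hβ0 : 0 < β := by linarith
  -- Three errors of size η/3 are allowed. This one pays for replacing p^β by min(p, 1)² where p < 1
  -- + ε.
  obtain ⟨ε, hε, hεη, hε1⟩ : ∃ ε : ℝ, 0 < ε ∧ ε ≤ η ∧ (1 + ε) ^ β ≤ 1 + η / 3 := by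
    have hc : Tendsto (fun ε : ℝ => (1 + ε) ^ β) (𝓝[>] 0) (𝓝 ((1 + 0) ^ β)) := by
      have : Continuous fun ε : ℝ => (1 + ε) ^ β :=
        (Real.continuous_rpow_const hβ0.le).comp (by fun_prop)
      exact this.continuousAt.tendsto.mono_left nhdsWithin_le_nhds
    have h1 : ∀ᶠ ε : ℝ in 𝓝[>] 0, (1 + ε) ^ β < 1 + η / 3 := by
      refine hc.eventually_lt_const ?_
      simp; positivity
    have h2 : ∀ᶠ ε : ℝ in 𝓝[>] 0, ε < η :=
      nhdsWithin_le_nhds (Iio_mem_nhds hη)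
    obtain ⟨ε, a, b, c⟩ := (h1.and (h2.and self_mem_nhdsWithin)).exists
    exact ⟨ε, c, b.le, a.le⟩
  -- The profile plus 1 dominates N·t and has integral at most 1, so the tail `t` has integral at
  -- most 1/N = η/3.
  set N : ℝ := 3 / η with hN
  have hN0 : 0 < N := by positivity
  refine ⟨max (2 * β) (max (8 * (N + 1) / Real.log (1 + ε) ^ 2) (3 * β / η)), le_max_left _ _, ?_⟩
  intro α hα X _ π _ p hpm hp κ hκ0 hκ1 hE
  have hα1 : 2 * β ≤ α := (le_max_left _ _).trans hα
  have hα2 : 8 * (N + 1) / Real.log (1 + ε) ^ 2 ≤ α :=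
    (le_max_left _ _).trans ((le_max_right _ _).trans hα)
  have hα3 : 3 * β / η ≤ α := (le_max_right _ _).trans ((le_max_right _ _).trans hα)
  have hα0 : 0 < α := by linarith
  have hαβ : 1 / α ≤ 1 / β := one_div_le_one_div_of_le hβ0 (by linarith)
  have hβ1 : 1 / β ≤ 1 := by rw [div_le_one hβ0]; linarith
  have hα' : 0 ≤ 1 / α := by positivity
  have hlow : ∀ q : ℝ, 0 ≤ q → -1 ≤ powerProfile α β q := fun q hq => by
    have := one_div_sub_one_div_le_powerProfile hβ0 (by linarith : β ≤ α) hq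
    linarith
  have hgm : Measurable fun x => powerProfile α β (p x) := by
    unfold powerProfile; fun_prop
  obtain ⟨hgI, hg⟩ := integrable_of_extIntegral_le hgm.aestronglyMeasurable
    (fun x => hlow (p x) (hp x)) hE
  have hg0 : ∫ x, powerProfile α β (p x) ∂π ≤ 0 :=
    hg.trans (mul_nonpos_of_nonpos_of_nonneg (by linarith) hκ0)
  set t : X → ℝ := fun x => if 1 + ε ≤ p x then p x ^ β else 0 with ht
  have htm : Measurable t :=
    Measurable.ite (measurableSet_le measurable_const hpm) (by fun_prop) measurable_const
  have ht0 : ∀ x, 0 ≤ t x := fun x => by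
    simp only [ht]; split_ifs
    · exact Real.rpow_nonneg (hp x) _
    · exact le_rfl
  have hNt : ∀ x, N * t x ≤ powerProfile α β (p x) + 1 := by
    intro x
    simp only [ht]; split_ifs with h
    · have := mul_le_powerProfile hβ hε hα1 hα2 h
      linarith
    · have := hlow (p x) (hp x)
      linarith
  have hg1 : Integrable (fun x => powerProfile α β (p x) + 1) π := hgI.add (integrable_const _)
  have hNtI : Integrable (fun x => N * t x) π := by
    refine hg1.mono' (htm.const_mul N).aestronglyMeasurable (ae_of_all _ fun x => ?_)
    rw [Real.norm_of_nonneg (mul_nonneg hN0.le (ht0 x))]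
    exact hNt x
  have htI : Integrable t π := by
    have := hNtI.const_mul N⁻¹
    refine this.congr (ae_of_all _ fun x => ?_)
    simp only
    rw [inv_mul_cancel_left₀ hN0.ne']
  have htle : ∫ x, t x ∂π ≤ η / 3 := by
    have h1 : ∫ x, N * t x ∂π ≤ ∫ x, (powerProfile α β (p x) + 1) ∂π :=
      integral_mono hNtI hg1 hNt
    rw [integral_const_mul, integral_add hgI (integrable_const _)] at h1
    simp only [integral_const, probReal_univ, smul_eq_mul, one_mul] at h1
    have h2 : N * ∫ x, t x ∂π ≤ 1 := by linarith
    have h3 : ∫ x, t x ∂π ≤ 1 / N := by rw [le_div_iff₀ hN0]; linarith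
    rwa [hN, one_div_div] at h3
  have htail : ∀ x, tailSq η (p x) ≤ t x := by
    intro x
    simp only [ht, tailSq]
    split_ifs with h1 h2 h2
    · have : p x ^ (2 : ℝ) ≤ p x ^ β := Real.rpow_le_rpow_of_exponent_le (by linarith) hβ
      simpa using this
    · linarith
    · exact Real.rpow_nonneg (hp x) _
    · exact le_rfl
  have hmI : Integrable (fun x => min (p x) 1 ^ 2) π := by
    refine Integrable.of_bound (by fun_prop) 1 (ae_of_all _ fun x => ?_)
    have h0 : 0 ≤ min (p x) 1 := le_min (hp x) zero_le_one
    rw [Real.norm_of_nonneg (by positivity)]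
    exact pow_le_one₀ h0 (min_le_right _ _)
  have htailI : Integrable (fun x => tailSq η (p x)) π := by
    refine htI.mono' ((measurable_tailSq η).comp hpm).aestronglyMeasurable
      (ae_of_all _ fun x => ?_)
    rw [Real.norm_of_nonneg (tailSq_nonneg _ _)]
    exact htail x
  refine ⟨htailI, (integral_mono htailI htI htail).trans (by linarith), ?_⟩
  have hpt : ∀ x, -(((1 + η / 3) * min (p x) 1 ^ 2 + t x) / β) ≤ powerProfile α β (p x) := by
    intro x
    have hpβ : p x ^ β ≤ (1 + η / 3) * min (p x) 1 ^ 2 + t x := by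
      simp only [ht]
      split_ifs with h
      · have : 0 ≤ (1 + η / 3) * min (p x) 1 ^ 2 := by positivity
        linarith
      · push Not at h
        rw [add_zero]
        rcases le_total (p x) 1 with h1 | h1
        · rw [min_eq_left h1]
          have : p x ^ β ≤ p x ^ (2 : ℝ) :=
            Real.rpow_le_rpow_of_exponent_ge' (hp x) h1 (by norm_num) hβ
          rw [Real.rpow_two] at this
          nlinarith [sq_nonneg (p x)]
        · rw [min_eq_right h1]
          have : p x ^ β ≤ (1 + ε) ^ β := Real.rpow_le_rpow (hp x) h.le hβ0.le
          linarith
    have h1 : p x ^ β / β ≤ ((1 + η / 3) * min (p x) 1 ^ 2 + t x) / β := by gcongr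
    have h2 : 0 ≤ p x ^ α / α := div_nonneg (Real.rpow_nonneg (hp x) _) hα0.le
    unfold powerProfile
    linarith
  have hmono := integral_mono (μ := π)
    (((((hmI.const_mul (1 + η / 3)).add htI).div_const β).neg)) hgI hpt
  have hsum : ∫ x, -(((1 + η / 3) * min (p x) 1 ^ 2 + t x) / β) ∂π
      = -(((1 + η / 3) * ∫ x, min (p x) 1 ^ 2 ∂π + ∫ x, t x ∂π) / β) := by
    rw [integral_neg, integral_div, integral_add (hmI.const_mul _) htI, integral_const_mul]
  have hmono' : -(((1 + η / 3) * ∫ x, min (p x) 1 ^ 2 ∂π + ∫ x, t x ∂π) / β)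
      ≤ (1 / α - 1 / β) * κ := by
    rw [← hsum]; exact hmono.trans hg
  have hm1 : ∫ x, min (p x) 1 ^ 2 ∂π ≤ 1 := by
    have := integral_mono hmI (integrable_const (1 : ℝ)) fun x =>
      pow_le_one₀ (n := 2) (le_min (hp x) zero_le_one) (min_le_right (p x) 1)
    simpa using this
  set m := ∫ x, min (p x) 1 ^ 2 ∂π
  -- The third error: the distance of 1/α - 1/β from its limit -1/β, relative to 1/β.
  have hβα : β / α ≤ η / 3 := by
    rw [div_le_iff₀ hη] at hα3
    rw [div_le_iff₀ hα0]; linarith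
  have h5 : (1 - β / α) * κ ≤ (1 + η / 3) * m + ∫ x, t x ∂π := by
    have := mul_le_mul_of_nonneg_left hmono' hβ0.le
    have e1 : β * -(((1 + η / 3) * m + ∫ x, t x ∂π) / β) = -((1 + η / 3) * m + ∫ x, t x ∂π) := by
      field_simp
    have e2 : β * ((1 / α - 1 / β) * κ) = -((1 - β / α) * κ) := by
      field_simp
      ring
    rw [e1, e2] at this
    linarith
  have h6 : β / α * κ ≤ η / 3 := by
    have : β / α * κ ≤ β / α * 1 := mul_le_mul_of_nonneg_left hκ1 (by positivity)
    linarith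
  nlinarith

/-! ### Transport estimates -/

lemma sq_rpow_inv_two {x : ℝ} (hx : 0 ≤ x) : (x ^ 2) ^ ((2 : ℝ)⁻¹) = x := by
  simpa using Real.pow_rpow_inv_natCast hx two_ne_zero

/-- Splitting a measure into pieces of equal mass, each transported to one point. -/
lemma d2_uniformProbability_le_of_partition (μ : ProbabilityMeasure (E n))
    (v : Fin (n + 1) → E n) (γ : Fin (n + 1) → E n → ℝ) (hγm : ∀ i, Measurable (γ i))
    (hγ0 : ∀ i x, 0 ≤ γ i x) (hγ1 : ∀ x, ∑ i, γ i x = 1)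
    (hγμ : ∀ i, ∫ x, γ i x ∂(μ : Measure (E n)) = 1 / (n + 1))
    {c : E n → ℝ} (hcI : Integrable c (μ : Measure (E n)))
    (hc : ∀ x, ∑ i, γ i x * ‖x - v i‖ ^ 2 ≤ c x) {ε : ℝ} (hε : 0 ≤ ε)
    (hcε : ∫ x, c x ∂(μ : Measure (E n)) ≤ ε ^ 2) :
    d2 μ (uniformProbability v) ≤ ENNReal.ofReal ε := by
  set g : Fin (n + 1) → E n → ℝ≥0∞ := fun i x => ENNReal.ofReal (γ i x)
  have hgm : ∀ i, Measurable (g i) := fun i => (hγm i).ennreal_ofReal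
  have hmk : ∀ i, Measurable fun x : E n => (x, v i) := fun i => by fun_prop
  -- The coupling that sends the part of `μ` with density `γ i` to the point `v i`.
  set π : Measure (E n × E n) :=
    ∑ i, ((μ : Measure (E n)).withDensity (g i)).map fun x => (x, v i) with hπ
  have hγI : ∀ i, Integrable (γ i) (μ : Measure (E n)) := fun i => by
    refine Integrable.of_bound (hγm i).aestronglyMeasurable 1 (ae_of_all _ fun x => ?_)
    rw [Real.norm_of_nonneg (hγ0 i x), ← hγ1 x]
    exact Finset.single_le_sum (f := fun i => γ i x) (fun i _ => hγ0 i x) (Finset.mem_univ i)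
  have hgμ : ∀ i, ∫⁻ x, g i x ∂(μ : Measure (E n)) = ((n : ℝ≥0∞) + 1)⁻¹ := by
    intro i
    rw [← ofReal_integral_eq_lintegral_ofReal (hγI i) (ae_of_all _ (hγ0 i)), hγμ, one_div,
      ENNReal.ofReal_inv_of_pos (by positivity), ENNReal.ofReal_add (by positivity) (by norm_num)]
    simp
  have hfst : π.map Prod.fst = μ := by
    ext s hs
    rw [Measure.map_apply measurable_fst hs, hπ, Measure.coe_finsetSum, Finset.sum_apply]
    simp only [Measure.map_apply (hmk _) (measurable_fst hs)]
    have e : ∀ i, (fun x : E n => (x, v i)) ⁻¹' (Prod.fst ⁻¹' s) = s := fun i => rfl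
    simp only [e, withDensity_apply _ hs]
    rw [← lintegral_finsetSum _ fun i _ => hgm i]
    have h1 : ∀ x, ∑ i, g i x = 1 := by
      intro x
      simp only [g]
      rw [← ENNReal.ofReal_sum_of_nonneg fun i _ => hγ0 i x, hγ1, ENNReal.ofReal_one]
    simp [h1]
  have hsnd : π.map Prod.snd = uniformMeasure v := by
    ext s hs
    rw [Measure.map_apply measurable_snd hs, hπ, Measure.coe_finsetSum, Finset.sum_apply,
      uniformMeasure_apply v hs, Finset.mul_sum]
    refine Finset.sum_congr rfl fun i _ => ?_
    rw [Measure.map_apply (hmk _) (measurable_snd hs)]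
    by_cases hi : v i ∈ s
    · have e : (fun x : E n => (x, v i)) ⁻¹' (Prod.snd ⁻¹' s) = Set.univ :=
        Set.eq_univ_of_forall fun x => hi
      rw [e, withDensity_apply _ MeasurableSet.univ, Measure.restrict_univ, hgμ]
      simp [hi]
    · have e : (fun x : E n => (x, v i)) ⁻¹' (Prod.snd ⁻¹' s) = ∅ :=
        Set.eq_empty_of_forall_notMem fun x => hi
      rw [e]
      simp [hi]
  refine (iInf₂_le π ⟨hfst, hsnd⟩).trans ?_
  have hcost : ∫⁻ p, ‖p.1 - p.2‖ₑ ^ 2 ∂π ≤ ENNReal.ofReal (ε ^ 2) := by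
    have hm : Measurable fun p : E n × E n => ‖p.1 - p.2‖ₑ ^ 2 := by fun_prop
    rw [hπ, lintegral_finsetSum_measure]
    have e : ∀ i, ∫⁻ p, ‖p.1 - p.2‖ₑ ^ 2
        ∂(((μ : Measure (E n)).withDensity (g i)).map fun x => (x, v i))
        = ∫⁻ x, g i x * ‖x - v i‖ₑ ^ 2 ∂(μ : Measure (E n)) := by
      intro i
      rw [lintegral_map hm (hmk i), lintegral_withDensity_eq_lintegral_mul _ (hgm i)
        (by fun_prop)]
      rfl
    simp only [e]
    rw [← lintegral_finsetSum _ fun i _ => by have := hgm i; fun_prop]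
    have h2 : ∀ x, ∑ i, g i x * ‖x - v i‖ₑ ^ 2 ≤ ENNReal.ofReal (c x) := by
      intro x
      refine le_trans (le_of_eq ?_) (ENNReal.ofReal_le_ofReal (hc x))
      rw [ENNReal.ofReal_sum_of_nonneg fun i _ => mul_nonneg (hγ0 i x) (by positivity)]
      refine Finset.sum_congr rfl fun i _ => ?_
      rw [ENNReal.ofReal_mul (hγ0 i x), ENNReal.ofReal_pow (norm_nonneg _), ofReal_norm]
    refine (lintegral_mono h2).trans ?_
    rw [← ofReal_integral_eq_lintegral_ofReal hcI (ae_of_all _ fun x =>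
      (Finset.sum_nonneg fun i _ => mul_nonneg (hγ0 i x) (by positivity)).trans (hc x))]
    exact ENNReal.ofReal_le_ofReal hcε
  rw [eLpNorm_eq_lintegral_rpow_enorm_toReal (by norm_num) (by norm_num)]
  simp only [ENNReal.toReal_ofNat, ENNReal.rpow_ofNat, one_div]
  have h3 : (∫⁻ p, ‖p.1 - p.2‖ₑ ^ 2 ∂π) ^ ((2 : ℝ)⁻¹) ≤ (ENNReal.ofReal (ε ^ 2)) ^ ((2 : ℝ)⁻¹) :=
    ENNReal.rpow_le_rpow hcost (by norm_num)
  refine h3.trans (le_of_eq ?_)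
  rw [ENNReal.ofReal_rpow_of_nonneg (by positivity) (by norm_num), sq_rpow_inv_two hε]

lemma sq_le_add_tailSq {η p : ℝ} (hη : 0 ≤ η) (hη1 : η ≤ 1) (hp : 0 ≤ p) :
    p ^ 2 ≤ 4 + tailSq η p := by
  unfold tailSq
  split_ifs with h
  · linarith
  · nlinarith

section Tail

variable {μ : ProbabilityMeasure (E n)} {η : ℝ}

lemma integrable_prod_norm_sub_sq (hη : 0 ≤ η) (hη1 : η ≤ 1)
    (ht : Integrable (fun z : E n × E n => tailSq η ‖z.1 - z.2‖)
      ((μ : Measure (E n)).prod (μ : Measure (E n)))) :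
    Integrable (fun z : E n × E n => ‖z.1 - z.2‖ ^ 2)
      ((μ : Measure (E n)).prod (μ : Measure (E n))) := by
  refine ((integrable_const (4 : ℝ)).add ht).mono' (by fun_prop) (ae_of_all _ fun z => ?_)
  rw [Real.norm_of_nonneg (by positivity)]
  exact sq_le_add_tailSq hη hη1 (norm_nonneg _)

lemma integrable_id_of_centered (hμ : μ ∈ centered n) :
    Integrable (fun x : E n => x) (μ : Measure (E n)) := by
  refine (hμ.1.add (integrable_const 1)).mono' (by fun_prop) (ae_of_all _ fun x => ?_)
  simp only [Pi.add_apply]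
  nlinarith [sq_nonneg (‖x‖ - 1), norm_nonneg x]

/-- Uniform integrability of the second moment. -/
lemma integral_mul_norm_sq_le (hμ : μ ∈ centered n) (hη : 0 ≤ η) (hη1 : η ≤ 1)
    (ht : Integrable (fun z : E n × E n => tailSq η ‖z.1 - z.2‖)
      ((μ : Measure (E n)).prod (μ : Measure (E n))))
    (htη : ∫ z, tailSq η ‖z.1 - z.2‖ ∂((μ : Measure (E n)).prod (μ : Measure (E n))) ≤ η)
    {h : E n → ℝ} (hm : Measurable h) (h0 : ∀ x, 0 ≤ h x) (h1 : ∀ x, h x ≤ 1) :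
    ∫ x, h x * ‖x‖ ^ 2 ∂(μ : Measure (E n)) ≤ 4 * ∫ x, h x ∂(μ : Measure (E n)) + η := by
  have hn : ∀ x, ‖h x‖ ≤ 1 := fun x => by rw [Real.norm_of_nonneg (h0 x)]; exact h1 x
  have hI : Integrable h (μ : Measure (E n)) :=
    Integrable.of_bound hm.aestronglyMeasurable 1 (ae_of_all _ hn)
  have hp2 := integrable_prod_norm_sub_sq hη hη1 ht
  have hF : Integrable (fun z : E n × E n => h z.1 * ‖z.1 - z.2‖ ^ 2)
      ((μ : Measure (E n)).prod (μ : Measure (E n))) :=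
    hp2.bdd_mul (c := 1) (hm.comp measurable_fst).aestronglyMeasurable
      (ae_of_all _ fun z => hn z.1)
  have hh2 : Integrable (fun x => h x * ‖x‖ ^ 2) (μ : Measure (E n)) :=
    hμ.1.bdd_mul (c := 1) (by fun_prop) (ae_of_all _ hn)
  have hh1 : Integrable (fun z : E n × E n => h z.1)
      ((μ : Measure (E n)).prod (μ : Measure (E n))) := hI.comp_fst _
  calc ∫ x, h x * ‖x‖ ^ 2 ∂(μ : Measure (E n))
      ≤ ∫ x, ∫ y, h x * ‖x - y‖ ^ 2 ∂(μ : Measure (E n)) ∂(μ : Measure (E n)) := by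
        -- For a centered measure, ‖x‖² is at most the mean of ‖x - y‖² over y.
        refine integral_mono hh2 hF.integral_prod_left fun x => ?_
        simp only
        rw [integral_const_mul, integral_norm_sub_sq (integrable_id_of_centered hμ) hμ.1 hμ.2]
        refine mul_le_mul_of_nonneg_left ?_ (h0 x)
        have : 0 ≤ traceMoment (μ : Measure (E n)) := integral_nonneg fun x => by positivity
        linarith
    _ = ∫ z, h z.1 * ‖z.1 - z.2‖ ^ 2 ∂((μ : Measure (E n)).prod (μ : Measure (E n))) :=
        (integral_prod _ hF).symm
    _ ≤ ∫ z, (4 * h z.1 + tailSq η ‖z.1 - z.2‖)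
          ∂((μ : Measure (E n)).prod (μ : Measure (E n))) := by
        refine integral_mono hF ((hh1.const_mul 4).add ht) fun z => ?_
        have e1 := mul_le_mul_of_nonneg_left
          (sq_le_add_tailSq hη hη1 (norm_nonneg (z.1 - z.2))) (h0 z.1)
        have e2 := mul_le_mul_of_nonneg_right (h1 z.1) (tailSq_nonneg η ‖z.1 - z.2‖)
        simp only
        linarith
    _ = 4 * ∫ x, h x ∂(μ : Measure (E n))
          + ∫ z, tailSq η ‖z.1 - z.2‖ ∂((μ : Measure (E n)).prod (μ : Measure (E n))) := by
        rw [integral_add (hh1.const_mul 4) ht, integral_const_mul, integral_fun_fst]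
        simp
    _ ≤ _ := by linarith

/-- A tent function around a point. -/
noncomputable def tent (δ : ℝ) (c x : E n) : ℝ := max 0 (1 - ‖x - c‖ / δ)

lemma continuous_tent (δ : ℝ) (c : E n) : Continuous (tent δ c) := by
  unfold tent; fun_prop

lemma tent_nonneg (δ : ℝ) (c x : E n) : 0 ≤ tent δ c x := le_max_left _ _

lemma tent_le_one {δ : ℝ} (hδ : 0 < δ) (c x : E n) : tent δ c x ≤ 1 := by
  have : 0 ≤ ‖x - c‖ / δ := by positivity
  exact max_le zero_le_one (by linarith)

lemma tent_eq_zero {δ : ℝ} (hδ : 0 < δ) {c x : E n} (h : δ ≤ ‖x - c‖) : tent δ c x = 0 := by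
  have : 1 ≤ ‖x - c‖ / δ := by rwa [le_div_iff₀ hδ, one_mul]
  exact max_eq_left (by linarith)

/-- Vertices are at distance 1 and tents have radius at most 1/2, so at most one tent is nonzero at
a point. -/
lemma sum_tent_le_one {v : Fin (n + 1) → E n} (hv : v ∈ unitSimplices n) {δ : ℝ} (hδ : 0 < δ)
    (hδ1 : δ ≤ 1 / 2) (x : E n) : ∑ i, tent δ (v i) x ≤ 1 := by
  by_cases h : ∃ i, ‖x - v i‖ < δ
  · obtain ⟨i, hi⟩ := h
    rw [Finset.sum_eq_single i]
    · exact tent_le_one hδ _ _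
    · intro j _ hj
      apply tent_eq_zero hδ
      have h1 := hv.1 i j hj.symm
      have h2 : ‖v i - v j‖ ≤ ‖x - v j‖ + ‖x - v i‖ := by
        have : v i - v j = (x - v j) - (x - v i) := by abel
        rw [this]; exact norm_sub_le _ _
      linarith
    · simp
  · push Not at h
    rw [Finset.sum_eq_zero fun i _ => tent_eq_zero hδ (h i)]
    exact zero_le_one

/-- Mass near a vertex goes to that vertex at cost at most δ². The remaining mass 1 - θ is shared
equally among the vertices; its cost is at most ∫ h(2‖x‖² + 2), and `integral_mul_norm_sq_le` bounds
this by 10(1 - θ) + 2η. -/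
lemma d2_uniformProbability_le_of_tent (hμ : μ ∈ centered n) (hη : 0 ≤ η) (hη1 : η ≤ 1)
    (ht : Integrable (fun z : E n × E n => tailSq η ‖z.1 - z.2‖)
      ((μ : Measure (E n)).prod (μ : Measure (E n))))
    (htη : ∫ z, tailSq η ‖z.1 - z.2‖ ∂((μ : Measure (E n)).prod (μ : Measure (E n))) ≤ η)
    {v : Fin (n + 1) → E n} (hv : v ∈ unitSimplices n) {δ : ℝ} (hδ : 0 < δ) (hδ1 : δ ≤ 1 / 2)
    {θ : ℝ} (hθ : 0 < θ)
    (hm : ∀ i, θ ≤ (n + 1) * ∫ x, tent δ (v i) x ∂(μ : Measure (E n))) {ε : ℝ} (hε : 0 ≤ ε)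
    (hle : δ ^ 2 + 10 * (1 - θ) + 2 * η ≤ ε ^ 2) :
    d2 μ (uniformProbability v) ≤ ENNReal.ofReal ε := by
  have hn : (0 : ℝ) < n + 1 := by positivity
  set m : Fin (n + 1) → ℝ := fun i => ∫ x, tent δ (v i) x ∂(μ : Measure (E n))
  have hm' : ∀ i, 0 < m i := fun i => by
    have := hθ.trans_le (hm i)
    exact pos_of_mul_pos_right this hn.le
  -- Rescaling gives every tent the same mass θ/(n+1); `hm` ensures that tents are only scaled down.
  set a : Fin (n + 1) → ℝ := fun i => θ / ((n + 1) * m i)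
  have ha0 : ∀ i, 0 ≤ a i := fun i => div_nonneg hθ.le (mul_nonneg hn.le (hm' i).le)
  have ha1 : ∀ i, a i ≤ 1 := fun i => by
    rw [div_le_one (mul_pos hn (hm' i))]; exact hm i
  set s : E n → ℝ := fun x => ∑ i, a i * tent δ (v i) x
  have hs0 : ∀ x, 0 ≤ s x := fun x =>
    Finset.sum_nonneg fun i _ => mul_nonneg (ha0 i) (tent_nonneg _ _ _)
  have hs1 : ∀ x, s x ≤ 1 := fun x =>
    (Finset.sum_le_sum fun i _ => mul_le_of_le_one_left (tent_nonneg _ _ _) (ha1 i)).trans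
      (sum_tent_le_one hv hδ hδ1 x)
  have hsc : Continuous s :=
    continuous_finsetSum _ fun i _ => (continuous_tent δ (v i)).const_mul (a i)
  set h : E n → ℝ := fun x => 1 - s x
  have hh0 : ∀ x, 0 ≤ h x := fun x => sub_nonneg.2 (hs1 x)
  have hh1 : ∀ x, h x ≤ 1 := fun x => by have := hs0 x; simp only [h]; linarith
  have hhc : Continuous h := continuous_const.sub hsc
  have htI : ∀ i, Integrable (tent δ (v i)) (μ : Measure (E n)) := fun i =>
    Integrable.of_bound (continuous_tent _ _).aestronglyMeasurable 1 (ae_of_all _ fun x => by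
      rw [Real.norm_of_nonneg (tent_nonneg _ _ _)]; exact tent_le_one hδ _ _)
  have hhI : Integrable h (μ : Measure (E n)) :=
    Integrable.of_bound hhc.aestronglyMeasurable 1 (ae_of_all _ fun x => by
      rw [Real.norm_of_nonneg (hh0 x)]; exact hh1 x)
  have ham : ∀ i, a i * m i = θ / (n + 1) := fun i => by
    have := (hm' i).ne'
    simp only [a]; field_simp
  have hhint : ∫ x, h x ∂(μ : Measure (E n)) = 1 - θ := by
    simp only [h, s]
    rw [integral_sub (integrable_const _) (integrable_finsetSum _ fun i _ => (htI i).const_mul _),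
      integral_finsetSum _ fun i _ => (htI i).const_mul _]
    simp only [integral_const_mul]
    have : ∀ i, a i * ∫ x, tent δ (v i) x ∂(μ : Measure (E n)) = θ / (n + 1) := ham
    simp only [this, Finset.sum_const, Finset.card_univ, Fintype.card_fin, nsmul_eq_mul]
    push_cast
    rw [mul_div_cancel₀ _ hn.ne']
    simp
  have hUI := integral_mul_norm_sq_le hμ hη hη1 ht htη hhc.measurable hh0 hh1
  have hh2 : Integrable (fun x => h x * ‖x‖ ^ 2) (μ : Measure (E n)) :=
    hμ.1.bdd_mul (c := 1) (by fun_prop) (ae_of_all _ fun x => by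
      rw [Real.norm_of_nonneg (hh0 x)]; exact hh1 x)
  refine d2_uniformProbability_le_of_partition μ v
    (fun i x => a i * tent δ (v i) x + h x / (n + 1)) (fun i => ?_) (fun i x => ?_) (fun x => ?_)
    (fun i => ?_) (c := fun x => δ ^ 2 + (2 * h x + 2 * (h x * ‖x‖ ^ 2))) ?_ (fun x => ?_) hε ?_
  · exact (((continuous_tent δ (v i)).const_mul (a i)).add (hhc.div_const _)).measurable
  · exact add_nonneg (mul_nonneg (ha0 i) (tent_nonneg _ _ _)) (div_nonneg (hh0 x) hn.le)
  · rw [Finset.sum_add_distrib]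
    simp only [Finset.sum_const, Finset.card_univ, Fintype.card_fin, nsmul_eq_mul]
    push_cast
    rw [mul_div_cancel₀ _ hn.ne']
    simp [h, s]
  · rw [integral_add ((htI i).const_mul _) (hhI.div_const _), integral_const_mul, integral_div,
      hhint]
    have : a i * ∫ x, tent δ (v i) x ∂(μ : Measure (E n)) = θ / (n + 1) := ham i
    rw [this]
    field_simp
    ring
  · exact (integrable_const _).add ((hhI.const_mul 2).add (hh2.const_mul 2))
  · have hd : ∀ i, (a i * tent δ (v i) x + h x / (n + 1)) * ‖x - v i‖ ^ 2
        ≤ a i * tent δ (v i) x * δ ^ 2 + h x / (n + 1) * (2 * ‖x‖ ^ 2 + 2) := by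
      intro i
      have e1 : tent δ (v i) x * ‖x - v i‖ ^ 2 ≤ tent δ (v i) x * δ ^ 2 := by
        rcases le_or_gt δ ‖x - v i‖ with hx | hx
        · rw [tent_eq_zero hδ hx]; simp
        · exact mul_le_mul_of_nonneg_left (pow_le_pow_left₀ (norm_nonneg _) hx.le 2)
            (tent_nonneg _ _ _)
      have e2 : ‖x - v i‖ ^ 2 ≤ 2 * ‖x‖ ^ 2 + 2 := by
        have k1 := norm_sub_le x (v i)
        have k2 := norm_le_one_of_mem_unitSimplices hv i
        have k3 : ‖x - v i‖ ≤ ‖x‖ + 1 := by linarith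
        have k4 := pow_le_pow_left₀ (norm_nonneg _) k3 2
        nlinarith [sq_nonneg (‖x‖ - 1)]
      have e3 := mul_le_mul_of_nonneg_left e1 (ha0 i)
      have e4 := mul_le_mul_of_nonneg_left e2 (div_nonneg (hh0 x) hn.le)
      linarith
    refine (Finset.sum_le_sum fun i _ => hd i).trans ?_
    rw [Finset.sum_add_distrib, ← Finset.sum_mul]
    simp only [Finset.sum_const, Finset.card_univ, Fintype.card_fin, nsmul_eq_mul]
    push_cast
    have e5 : ((n : ℝ) + 1) * (h x / (n + 1) * (2 * ‖x‖ ^ 2 + 2)) = h x * (2 * ‖x‖ ^ 2 + 2) := by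
      field_simp
    rw [e5]
    have e6 : s x * δ ^ 2 ≤ δ ^ 2 := mul_le_of_le_one_left (by positivity) (hs1 x)
    change s x * δ ^ 2 + _ ≤ _
    linarith
  · rw [integral_add (g := fun x => 2 * h x + 2 * (h x * ‖x‖ ^ 2)) (integrable_const _)
        ((hhI.const_mul 2).add (hh2.const_mul 2)),
      integral_add (hhI.const_mul 2) (hh2.const_mul 2), integral_const_mul, integral_const_mul,
      hhint]
    rw [hhint] at hUI
    simp only [integral_const, probReal_univ, smul_eq_mul, one_mul]
    linarith

/-- If the second measure has no mass near a point, transporting to it is expensive. -/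
lemma le_d2_of_support (μ ν : ProbabilityMeasure (E n)) {x : E n} {ρ t : ℝ} (hρ : 0 < ρ)
    (hν : ∀ y ∈ (ν : Measure (E n)).support, 2 * ρ ≤ ‖x - y‖) (ht : 0 ≤ t)
    (hμ : t ^ 2 ≤ ∫ y, tent ρ x y ∂(μ : Measure (E n))) :
    ENNReal.ofReal (ρ * t) ≤ d2 μ ν := by
  refine le_iInf₂ fun π hπ => ?_
  rw [eLpNorm_eq_lintegral_rpow_enorm_toReal (by norm_num) (by norm_num)]
  simp only [ENNReal.toReal_ofNat, ENNReal.rpow_ofNat, one_div]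
  have hae : ∀ᵐ p ∂π, 2 * ρ ≤ ‖x - p.2‖ := by
    have h1 : ∀ᵐ y ∂π.map Prod.snd, 2 * ρ ≤ ‖x - y‖ := by
      rw [hπ.2]
      filter_upwards [Measure.support_mem_ae] with y hy
      exact hν y hy
    exact ae_of_ae_map measurable_snd.aemeasurable h1
  have hcost : ENNReal.ofReal ((ρ * t) ^ 2) ≤ ∫⁻ p, ‖p.1 - p.2‖ₑ ^ 2 ∂π := by
    calc ENNReal.ofReal ((ρ * t) ^ 2)
        ≤ ENNReal.ofReal (∫ y, ρ ^ 2 * tent ρ x y ∂(μ : Measure (E n))) := by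
          refine ENNReal.ofReal_le_ofReal ?_
          rw [integral_const_mul, mul_pow]
          exact mul_le_mul_of_nonneg_left hμ (by positivity)
      _ = ∫⁻ y, ENNReal.ofReal (ρ ^ 2 * tent ρ x y) ∂(μ : Measure (E n)) := by
          refine ofReal_integral_eq_lintegral_ofReal (Integrable.const_mul ?_ _)
            (ae_of_all _ fun y => mul_nonneg (by positivity) (tent_nonneg _ _ _))
          exact Integrable.of_bound (continuous_tent _ _).aestronglyMeasurable 1
            (ae_of_all _ fun y => by
              rw [Real.norm_of_nonneg (tent_nonneg _ _ _)]; exact tent_le_one hρ _ _)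
      _ = ∫⁻ p, ENNReal.ofReal (ρ ^ 2 * tent ρ x p.1) ∂π := by
          rw [← hπ.1, lintegral_map _ measurable_fst]
          exact ((continuous_tent ρ x).const_mul _).measurable.ennreal_ofReal
      _ ≤ ∫⁻ p, ‖p.1 - p.2‖ₑ ^ 2 ∂π := by
          refine lintegral_mono_ae ?_
          filter_upwards [hae] with p hp
          rw [← ofReal_norm, ← ENNReal.ofReal_pow (norm_nonneg _)]
          refine ENNReal.ofReal_le_ofReal ?_
          rcases le_or_gt ρ ‖p.1 - x‖ with h | h
          · rw [tent_eq_zero hρ h]; simp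
          · have h1 : ‖x - p.2‖ ≤ ‖p.1 - p.2‖ + ‖p.1 - x‖ := by
              have : x - p.2 = (p.1 - p.2) - (p.1 - x) := by abel
              rw [this]; exact norm_sub_le _ _
            have h2 : ρ ≤ ‖p.1 - p.2‖ := by linarith
            have h3 := pow_le_pow_left₀ hρ.le h2 2
            have h4 : ρ ^ 2 * tent ρ x p.1 ≤ ρ ^ 2 :=
              mul_le_of_le_one_right (by positivity) (tent_le_one hρ _ _)
            linarith
  have h3 : (ENNReal.ofReal ((ρ * t) ^ 2)) ^ ((2 : ℝ)⁻¹)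
      ≤ (∫⁻ p, ‖p.1 - p.2‖ₑ ^ 2 ∂π) ^ ((2 : ℝ)⁻¹) :=
    ENNReal.rpow_le_rpow hcost (by norm_num)
  refine le_trans (le_of_eq ?_) h3
  rw [ENNReal.ofReal_rpow_of_nonneg (by positivity) (by norm_num),
    sq_rpow_inv_two (by positivity)]

end Tail

/-! ### Concentration and weak limits -/

/-- A nonnegative function that exceeds `1 + η` rarely and is close to one often. -/
structure Concentrated {X : Type*} [MeasurableSpace X] (π : Measure X) (p : X → ℝ) (κ η : ℝ) :
    Prop where
  integrable_tail : Integrable (fun x => tailSq η (p x)) π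
  integral_tail_le : ∫ x, tailSq η (p x) ∂π ≤ η
  le_integral_min : κ - η ≤ ∫ x, min (p x) 1 ^ 2 ∂π

/-- The excess over one, truncated. -/
noncomputable def excess (p : ℝ) : ℝ := min (max (p - 1) 0) 1

lemma excess_nonneg (p : ℝ) : 0 ≤ excess p := le_min (le_max_right _ _) zero_le_one

lemma excess_le_one (p : ℝ) : excess p ≤ 1 := min_le_right _ _

lemma continuous_excess : Continuous excess := by unfold excess; fun_prop

lemma excess_le_add_tailSq {η : ℝ} (hη : 0 ≤ η) (p : ℝ) : excess p ≤ η + tailSq η p := by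
  unfold tailSq
  split_ifs with h
  · have := excess_le_one p
    nlinarith
  · push Not at h
    rw [add_zero]
    exact (min_le_left _ _).trans (max_le (by linarith) hη)

lemma min_one_sq_nonneg_le {p : ℝ} (hp : 0 ≤ p) : 0 ≤ min p 1 ^ 2 ∧ min p 1 ^ 2 ≤ 1 :=
  ⟨by positivity, pow_le_one₀ (le_min hp zero_le_one) (min_le_right _ _)⟩

/-- Both conclusions are read off from bounded continuous test functions: the truncated excess has
vanishing limit, so p₀ ≤ 1 almost surely, and then min(p₀, 1)² is p₀². -/
lemma limit_of_concentrated {X : Type*} [MeasurableSpace X] {ι : Type*} {l : Filter ι} [l.NeBot]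
    {π : ι → Measure X} [∀ k, IsProbabilityMeasure (π k)] {π₀ : Measure X}
    [IsProbabilityMeasure π₀] {p : ι → X → ℝ} {p₀ : X → ℝ} (hp : ∀ k, Measurable (p k))
    (hp₀ : Measurable p₀) {κ : ℝ}
    (hc : ∀ η, 0 < η → ∀ᶠ k in l, Concentrated (π k) (p k) κ η)
    (hexc : Tendsto (fun k => ∫ x, excess (p k x) ∂π k) l (𝓝 (∫ x, excess (p₀ x) ∂π₀)))
    (hmin : Tendsto (fun k => ∫ x, min (p k x) 1 ^ 2 ∂π k) l (𝓝 (∫ x, min (p₀ x) 1 ^ 2 ∂π₀))) :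
    (∀ᵐ x ∂π₀, p₀ x ≤ 1) ∧ κ ≤ ∫ x, p₀ x ^ 2 ∂π₀ := by
  have hI : ∀ {q : X → ℝ} {ρ : Measure X} [IsProbabilityMeasure ρ], Measurable q →
      Integrable (fun x => excess (q x)) ρ := fun hq =>
    Integrable.of_bound (continuous_excess.measurable.comp hq).aestronglyMeasurable 1
      (ae_of_all _ fun x => by rw [Real.norm_of_nonneg (excess_nonneg _)]; exact excess_le_one _)
  have h0 : ∫ x, excess (p₀ x) ∂π₀ ≤ 0 := by
    refine le_of_forall_pos_le_add fun η hη => ?_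
    rw [zero_add]
    refine le_of_tendsto hexc ?_
    filter_upwards [hc (η / 2) (by positivity)] with k hk
    have h1 : ∫ x, excess (p k x) ∂π k ≤ ∫ x, (η / 2 + tailSq (η / 2) (p k x)) ∂π k :=
      integral_mono (hI (hp k)) ((integrable_const _).add hk.integrable_tail)
        fun x => excess_le_add_tailSq (by positivity) _
    rw [integral_add (integrable_const _) hk.integrable_tail] at h1
    simp only [integral_const, probReal_univ, smul_eq_mul, one_mul] at h1
    have := hk.integral_tail_le
    linarith
  have h0' : ∫ x, excess (p₀ x) ∂π₀ = 0 :=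
    le_antisymm h0 (integral_nonneg fun x => excess_nonneg _)
  rw [integral_eq_zero_iff_of_nonneg (fun x => excess_nonneg _) (hI hp₀)] at h0'
  have hle : ∀ᵐ x ∂π₀, p₀ x ≤ 1 := by
    filter_upwards [h0'] with x hx
    by_contra hlt
    push Not at hlt
    have : 0 < excess (p₀ x) := lt_min (lt_max_of_lt_left (by linarith)) one_pos
    exact this.ne' hx
  refine ⟨hle, ?_⟩
  have e : ∫ x, p₀ x ^ 2 ∂π₀ = ∫ x, min (p₀ x) 1 ^ 2 ∂π₀ := by
    refine integral_congr_ae ?_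
    filter_upwards [hle] with x hx
    rw [min_eq_left hx]
  rw [e]
  refine le_of_forall_pos_le_add fun η hη => ?_
  have : κ - η ≤ ∫ x, min (p₀ x) 1 ^ 2 ∂π₀ := by
    refine ge_of_tendsto hmin ?_
    filter_upwards [hc η hη] with k hk
    exact hk.le_integral_min
  linarith

lemma tendsto_integral_of_bounded {Y : Type*} [MeasurableSpace Y] [TopologicalSpace Y]
    [OpensMeasurableSpace Y] {ι : Type*} {l : Filter ι} {μ : ι → ProbabilityMeasure Y}
    {μ₀ : ProbabilityMeasure Y} (h : Tendsto μ l (𝓝 μ₀)) {F : Y → ℝ} (hF : Continuous F) {C : ℝ}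
    (hC : ∀ y, ‖F y‖ ≤ C) :
    Tendsto (fun k => ∫ y, F y ∂(μ k : Measure Y)) l (𝓝 (∫ y, F y ∂(μ₀ : Measure Y))) :=
  ProbabilityMeasure.tendsto_iff_forall_integral_tendsto.1 h
    (BoundedContinuousFunction.ofNormedAddCommGroup F hF C hC)

/-- Weak convergence may be combined with uniform convergence of the test functions. -/
lemma tendsto_integral_of_bounded_of_dist {ι : Type*} {l : Filter ι}
    {μ : ι → ProbabilityMeasure (E n)} {μ₀ : ProbabilityMeasure (E n)} (h : Tendsto μ l (𝓝 μ₀))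
    {x : ι → E n} {x₀ : E n} (hx : Tendsto x l (𝓝 x₀)) {F : ℝ → ℝ} (hF : Continuous F)
    (hC : ∀ t, 0 ≤ t → ‖F t‖ ≤ 1) {L : ℝ} (hL0 : 0 ≤ L)
    (hL : ∀ s t, 0 ≤ s → 0 ≤ t → |F s - F t| ≤ L * |s - t|) :
    Tendsto (fun k => ∫ y, F ‖x k - y‖ ∂(μ k : Measure (E n))) l
      (𝓝 (∫ y, F ‖x₀ - y‖ ∂(μ₀ : Measure (E n)))) := by
  have h1 := tendsto_integral_of_bounded h (F := fun y => F ‖x₀ - y‖) (by fun_prop)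
    fun y => hC _ (norm_nonneg _)
  have hI : ∀ (z : E n) (ν : ProbabilityMeasure (E n)),
      Integrable (fun y => F ‖z - y‖) (ν : Measure (E n)) := fun z ν =>
    Integrable.of_bound (by fun_prop) 1 (ae_of_all _ fun y => hC _ (norm_nonneg _))
  have h2 : Tendsto (fun k => ∫ y, F ‖x k - y‖ ∂(μ k : Measure (E n))
      - ∫ y, F ‖x₀ - y‖ ∂(μ k : Measure (E n))) l (𝓝 0) := by
    have h3 : Tendsto (fun k => L * ‖x k - x₀‖) l (𝓝 0) := by
      have := (tendsto_iff_norm_sub_tendsto_zero.1 hx).const_mul L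
      simpa using this
    refine squeeze_zero_norm (fun k => ?_) h3
    rw [← integral_sub (hI _ _) (hI _ _)]
    have := norm_integral_le_of_norm_le_const (μ := (μ k : Measure (E n)))
      (f := fun y => F ‖x k - y‖ - F ‖x₀ - y‖) (C := L * ‖x k - x₀‖) (ae_of_all _ fun y => by
        rw [Real.norm_eq_abs]
        refine (hL _ _ (norm_nonneg _) (norm_nonneg _)).trans
          (mul_le_mul_of_nonneg_left ?_ hL0)
        have := abs_norm_sub_norm_le (x k - y) (x₀ - y)
        simpa using this)
    simpa using this
  have := h2.add h1
  simpa using this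

lemma abs_excess_sub_le (s t : ℝ) : |excess s - excess t| ≤ 1 * |s - t| := by
  unfold excess
  refine (abs_min_sub_min_le_max _ _ _ _).trans ?_
  simp only [sub_self, abs_zero, one_mul]
  refine max_le ((abs_max_sub_max_le_max _ _ _ _).trans ?_) (abs_nonneg _)
  simp

lemma abs_min_one_sq_sub_le {s t : ℝ} (hs : 0 ≤ s) (ht : 0 ≤ t) :
    |min s 1 ^ 2 - min t 1 ^ 2| ≤ 2 * |s - t| := by
  have h1 : |min s 1 - min t 1| ≤ |s - t| := by
    refine (abs_min_sub_min_le_max _ _ _ _).trans ?_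
    simp
  have h2 : min s 1 ^ 2 - min t 1 ^ 2 = (min s 1 + min t 1) * (min s 1 - min t 1) := by ring
  have hs0 : 0 ≤ min s 1 := le_min hs zero_le_one
  have ht0 : 0 ≤ min t 1 := le_min ht zero_le_one
  rw [h2, abs_mul, abs_of_nonneg (by positivity)]
  exact mul_le_mul (by linarith [min_le_right s 1, min_le_right t 1]) h1 (abs_nonneg _) (by norm_num)

lemma isTightMeasureSet_of_second_moment (C : ℝ) :
    IsTightMeasureSet {ν : Measure (E n) | ∃ μ ∈ {μ : ProbabilityMeasure (E n) |
      Integrable (fun x : E n => ‖x‖ ^ 2) (μ : Measure (E n)) ∧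
      ∫ x, ‖x‖ ^ 2 ∂(μ : Measure (E n)) ≤ C}, (μ : Measure (E n)) = ν} := by
  rw [isTightMeasureSet_iff_exists_isCompact_measure_compl_le]
  intro ε hε
  have h1 : Tendsto (fun R : ℝ => ENNReal.ofReal (C / R ^ 2)) atTop (𝓝 0) := by
    have : Tendsto (fun R : ℝ => C / R ^ 2) atTop (𝓝 0) :=
      tendsto_const_nhds.div_atTop (tendsto_pow_atTop two_ne_zero)
    simpa using ENNReal.tendsto_ofReal this
  obtain ⟨R, hR, hR0⟩ := ((h1.eventually_lt_const hε).and (eventually_gt_atTop 0)).exists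
  refine ⟨Metric.closedBall 0 R, isCompact_closedBall _ _, ?_⟩
  rintro _ ⟨μ, ⟨hI, hC⟩, rfl⟩
  refine le_trans ?_ hR.le
  have h2 := mul_meas_ge_le_integral_of_nonneg (μ := (μ : Measure (E n)))
    (ae_of_all _ fun x : E n => (by positivity : 0 ≤ ‖x‖ ^ 2)) hI (R ^ 2)
  have h3 : (μ : Measure (E n)).real (Metric.closedBall 0 R)ᶜ
      ≤ (μ : Measure (E n)).real {x | R ^ 2 ≤ ‖x‖ ^ 2} := by
    refine measureReal_mono fun x hx => ?_
    have : R < ‖x‖ := by simpa using hx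
    exact pow_le_pow_left₀ hR0.le this.le 2
  rw [← ofReal_measureReal]
  refine ENNReal.ofReal_le_ofReal ?_
  rw [le_div_iff₀ (by positivity)]
  have : 0 < R ^ 2 := by positivity
  nlinarith

/-- Coordinates are unbounded test functions, so they are truncated at height R. The bound on second
moments makes the error at most C/R, uniformly along the filter. -/
lemma mean_eq_zero_of_tendsto {ι : Type*} {l : Filter ι} [l.NeBot]
    {μ : ι → ProbabilityMeasure (E n)} {μ₀ : ProbabilityMeasure (E n)} (h : Tendsto μ l (𝓝 μ₀))
    (hc : ∀ k, μ k ∈ centered n) {C : ℝ}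
    (hC : ∀ᶠ k in l, ∫ x, ‖x‖ ^ 2 ∂(μ k : Measure (E n)) ≤ C) {R₀ : ℝ}
    (hb : ∀ᵐ x ∂(μ₀ : Measure (E n)), ‖x‖ ≤ R₀) : ∫ x, x ∂(μ₀ : Measure (E n)) = 0 := by
  have hI₀ : Integrable (fun x : E n => x) (μ₀ : Measure (E n)) :=
    integrable_of_continuous_of_ae_bounded hb continuous_id'
  have hcoord : ∀ a : Fin n, ∫ x : E n, x a ∂(μ₀ : Measure (E n)) = 0 := by
    intro a
    have hxa : ∀ x : E n, |x a| ≤ ‖x‖ := fun x => PiLp.norm_apply_le x a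
    -- R ≥ R₀ makes the truncation inactive under the limit measure.
    have key : ∀ R, max R₀ 1 ≤ R → |∫ x : E n, x a ∂(μ₀ : Measure (E n))| ≤ C / R := by
      intro R hR
      have hR1 : 0 < R := one_pos.trans_le ((le_max_right _ _).trans hR)
      set F : E n → ℝ := fun x => max (-R) (min R (x a)) with hF
      have hFc : Continuous F := by fun_prop
      have hFb : ∀ x, ‖F x‖ ≤ R := fun x => by
        rw [Real.norm_eq_abs, abs_le]
        exact ⟨le_max_left _ _, max_le (by linarith) (min_le_left _ _)⟩
      have hFx : ∀ x, |F x - x a| ≤ ‖x‖ ^ 2 / R := by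
        intro x
        rw [le_div_iff₀ hR1]
        have h1 := hxa x
        have h3 := abs_nonneg (x a)
        have h2 : |x a| ^ 2 ≤ ‖x‖ ^ 2 := pow_le_pow_left₀ h3 h1 2
        rcases le_or_gt |x a| R with hx | hx
        · have h4 := abs_le.1 hx
          have : F x = x a := by
            simp only [hF]; rw [min_eq_right h4.2, max_eq_right h4.1]
          rw [this, sub_self, abs_zero, zero_mul]; positivity
        · have h5 : |F x - x a| ≤ |x a| := by
            simp only [hF]
            rcases lt_abs.1 hx with h6 | h6
            · rw [min_eq_left h6.le, max_eq_right (by linarith), abs_of_nonpos (by linarith),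
                abs_of_pos (by linarith)]
              linarith
            · rw [min_eq_right (by linarith), max_eq_left (by linarith), abs_of_nonneg (by linarith),
                abs_of_neg (by linarith)]
              linarith
          nlinarith
      have e : ∫ x : E n, x a ∂(μ₀ : Measure (E n)) = ∫ x, F x ∂(μ₀ : Measure (E n)) := by
        refine integral_congr_ae ?_
        filter_upwards [hb] with x hx
        have h4 := abs_le.1 ((hxa x).trans (hx.trans ((le_max_left _ _).trans hR)))
        simp only [hF]; rw [min_eq_right h4.2, max_eq_right h4.1]
      rw [e]
      refine le_of_tendsto (tendsto_integral_of_bounded h hFc hFb).abs ?_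
      filter_upwards [hC] with k hk
      have hIk := integrable_id_of_centered (hc k)
      have hFI : Integrable F (μ k : Measure (E n)) :=
        Integrable.of_bound hFc.aestronglyMeasurable R (ae_of_all _ hFb)
      have hxI : Integrable (fun x : E n => x a) (μ k : Measure (E n)) :=
        hIk.mono (by fun_prop) (ae_of_all _ fun x => hxa x)
      have h0 := integral_coord_eq_zero hIk (hc k).2 a
      have h1 : ∫ x, F x ∂(μ k : Measure (E n)) = ∫ x, (F x - x a) ∂(μ k : Measure (E n)) := by
        rw [integral_sub hFI hxI, h0, sub_zero]
      rw [h1]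
      calc |∫ x, (F x - x a) ∂(μ k : Measure (E n))|
          ≤ ∫ x, |F x - x a| ∂(μ k : Measure (E n)) := abs_integral_le_integral_abs
        _ ≤ ∫ x, ‖x‖ ^ 2 / R ∂(μ k : Measure (E n)) :=
          integral_mono (hFI.sub hxI).abs ((hc k).1.div_const R) hFx
        _ ≤ C / R := by
          rw [integral_div]
          exact div_le_div_of_nonneg_right hk hR1.le
    have hlim : Tendsto (fun R : ℝ => C / R) atTop (𝓝 0) :=
      tendsto_const_nhds.div_atTop tendsto_id
    have h0 : |∫ x : E n, x a ∂(μ₀ : Measure (E n))| ≤ 0 :=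
      ge_of_tendsto hlim ((eventually_ge_atTop _).mono fun R hR => key R hR)
    exact abs_nonpos_iff.1 h0
  ext a
  simpa [hcoord] using
    ((EuclideanSpace.proj (𝕜 := ℝ) a : E n →L[ℝ] ℝ).integral_comp_comm hI₀).symm

/-! ### Concentration for power-law minimizers -/

/-- The minimal value of the potential is at most the energy. -/
lemma potential_le_of_mem_argmin {α β : ℝ} (hβ : 0 < β) (hαβ : β ≤ α)
    {μ : ProbabilityMeasure (E n)} {c : ℝ} (h : energy (powerLaw α β) μ ≤ (c : EReal)) {x : E n}
    (hx : x ∈ argmin Set.univ (potential (powerLaw α β) μ)) :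
    potential (powerLaw α β) μ x ≤ (c : EReal) := by
  have hm : Measurable fun z : E n × E n => powerProfile α β ‖z.1 - z.2‖ := by
    unfold powerProfile; fun_prop
  obtain ⟨hI, hle⟩ := integrable_of_extIntegral_le (C := 1 / β - 1 / α) hm.aestronglyMeasurable
    (fun z => by
      have := one_div_sub_one_div_le_powerProfile hβ hαβ (norm_nonneg (z.1 - z.2))
      linarith) h
  rw [integral_prod _ hI] at hle
  -- The energy is the mean of the potential, so some point has potential at most the energy; it is
  -- taken off the null set of non-integrable fibers.
  obtain ⟨x₀, hx₀, hx₀le⟩ := exists_notMem_null_le_integral hI.integral_prod_left hI.prod_right_ae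
  have hx₀I : Integrable (fun y => powerProfile α β ‖x₀ - y‖) (μ : Measure (E n)) := by
    simpa using hx₀
  refine (hx.2 (Set.mem_univ x₀)).trans ?_
  have e : potential (powerLaw α β) μ x₀
      = ((∫ y, powerProfile α β ‖x₀ - y‖ ∂(μ : Measure (E n)) : ℝ) : EReal) :=
    extIntegral_coe_of_integrable hx₀I
  change potential (powerLaw α β) μ x₀ ≤ _
  rw [e]
  exact EReal.coe_le_coe_iff.2 (hx₀le.trans hle)

/-- For large exponents, distances under a minimizer, and distances from a minimum point of its
potential, are concentrated. -/
lemma exists_forall_concentrated (n : ℕ) {β : ℝ} (hβ : 2 ≤ β) {η : ℝ} (hη : 0 < η) :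
    ∃ α₁ : ℝ, ∀ α, α₁ ≤ α → ∀ μ ∈ argmin (centered n) (energy (powerLaw α β)),
      Concentrated ((μ : Measure (E n)).prod (μ : Measure (E n))) (fun z => ‖z.1 - z.2‖)
        (n / (n + 1)) η ∧
      ∀ x ∈ argmin Set.univ (potential (powerLaw α β) μ),
        Concentrated (μ : Measure (E n)) (fun y => ‖x - y‖) (n / (n + 1)) η := by
  obtain ⟨α₁, hα₁, H⟩ := exists_forall_powerProfile_concentration hβ hη
  refine ⟨α₁, fun α hα μ hμ => ?_⟩
  obtain ⟨v, hv⟩ := unitSimplices_nonempty n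
  have hex : IsExtremal (uniformProbability v : Measure (E n)) := isExtremal_uniformMeasure hv
  have hE : energy (powerLaw α β) μ
      ≤ (((1 / α - 1 / β) * ((n : ℝ) / (n + 1)) : ℝ) : EReal) := by
    rw [← hex.energy_powerLaw (by linarith) (by linarith)]
    exact hμ.2 hex.mem_centered
  have hκ0 : 0 ≤ (n : ℝ) / (n + 1) := by positivity
  have hκ1 : (n : ℝ) / (n + 1) ≤ 1 := by
    rw [div_le_one (by positivity)]; linarith
  refine ⟨?_, fun x hx => ?_⟩
  · obtain ⟨a, b, c⟩ := H α hα ((μ : Measure (E n)).prod (μ : Measure (E n)))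
      (fun z => ‖z.1 - z.2‖) (by fun_prop) (fun _ => norm_nonneg _) _ hκ0 hκ1 hE
    exact ⟨a, b, c⟩
  · obtain ⟨a, b, c⟩ := H α hα (μ : Measure (E n))
      (fun y => ‖x - y‖) (by fun_prop) (fun _ => norm_nonneg _) _ hκ0 hκ1
      (potential_le_of_mem_argmin (by linarith) (by linarith) hE hx)
    exact ⟨a, b, c⟩

/-- Uniform integrability with weight 1 and η = 1; any uniform bound would do, as it serves only
tightness and the limit of the means. -/
lemma Concentrated.second_moment_le {μ : ProbabilityMeasure (E n)} (hμ : μ ∈ centered n) {κ : ℝ}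
    (h : Concentrated ((μ : Measure (E n)).prod (μ : Measure (E n)))
      (fun z => ‖z.1 - z.2‖) κ 1) : ∫ x, ‖x‖ ^ 2 ∂(μ : Measure (E n)) ≤ 5 := by
  have := integral_mul_norm_sq_le hμ zero_le_one le_rfl h.integrable_tail h.integral_tail_le
    (h := fun _ => 1) measurable_const (fun _ => zero_le_one) (fun _ => le_rfl)
  simp only [one_mul, integral_const, probReal_univ, smul_eq_mul, mul_one] at this
  linarith

lemma Concentrated.norm_le {μ : ProbabilityMeasure (E n)} (hμ : μ ∈ centered n) {κ : ℝ} {x : E n}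
    (h : Concentrated (μ : Measure (E n)) (fun y => ‖x - y‖) κ 1) : ‖x‖ ≤ 3 := by
  have h1 : Integrable (fun y => ‖x - y‖ ^ 2) (μ : Measure (E n)) := by
    refine ((integrable_const (4 : ℝ)).add h.integrable_tail).mono' (by fun_prop)
      (ae_of_all _ fun z => ?_)
    rw [Real.norm_of_nonneg (by positivity)]
    exact sq_le_add_tailSq zero_le_one le_rfl (norm_nonneg _)
  have h2 := integral_mono h1 ((integrable_const (4 : ℝ)).add h.integrable_tail)
    fun y => sq_le_add_tailSq zero_le_one le_rfl (norm_nonneg (x - y))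
  have h3 : ∫ y, ((4 : ℝ) + tailSq 1 ‖x - y‖) ∂(μ : Measure (E n)) ≤ 5 := by
    rw [integral_add (integrable_const _) h.integrable_tail]
    have := h.integral_tail_le
    simp only [integral_const, probReal_univ, smul_eq_mul, one_mul]
    linarith
  have h4 := integral_norm_sub_sq (integrable_id_of_centered hμ) hμ.1 hμ.2 x
  have h5 : 0 ≤ traceMoment (μ : Measure (E n)) := integral_nonneg fun x => by positivity
  have h6 := h2.trans h3
  rw [h4] at h6
  nlinarith [norm_nonneg x]

lemma one_le_integral_tent (v : Fin (n + 1) → E n) {δ : ℝ} (i : Fin (n + 1)) :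
    1 ≤ (n + 1) * ∫ x, tent δ (v i) x ∂uniformMeasure v := by
  rw [integral_uniformMeasure, smul_eq_mul, mul_inv_cancel_left₀ (by positivity)]
  have h1 : tent δ (v i) (v i) = 1 := by simp [tent]
  rw [← h1]
  exact Finset.single_le_sum (f := fun j => tent δ (v i) (v j)) (fun j _ => tent_nonneg _ _ _)
    (Finset.mem_univ i)

/-! ### Limits of minimizers and of minimum points -/

section Limit

variable {ι : Type*} {l : Filter ι} {μ : ι → ProbabilityMeasure (E n)}
  {μ₀ : ProbabilityMeasure (E n)}

lemma isExtremal_of_tendsto [l.NeBot] (h : Tendsto μ l (𝓝 μ₀)) (hc : ∀ k, μ k ∈ centered n)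
    (hconc : ∀ η, 0 < η → ∀ᶠ k in l, Concentrated ((μ k : Measure (E n)).prod (μ k : Measure (E n)))
      (fun z => ‖z.1 - z.2‖) (n / (n + 1)) η) : IsExtremal (μ₀ : Measure (E n)) := by
  have hprod : Tendsto (fun k => (μ k).prod (μ k)) l (𝓝 (μ₀.prod μ₀)) :=
    (ProbabilityMeasure.continuous_prod.tendsto (μ₀, μ₀)).comp (h.prodMk_nhds h)
  have hexc := tendsto_integral_of_bounded hprod
    (F := fun z : E n × E n => excess ‖z.1 - z.2‖) (continuous_excess.comp (by fun_prop)) (C := 1)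
    fun z => by rw [Real.norm_of_nonneg (excess_nonneg _)]; exact excess_le_one _
  have hmin := tendsto_integral_of_bounded hprod
    (F := fun z : E n × E n => min ‖z.1 - z.2‖ 1 ^ 2) (by fun_prop) (C := 1)
    fun z => by
      have := min_one_sq_nonneg_le (norm_nonneg (z.1 - z.2))
      rw [Real.norm_of_nonneg this.1]; exact this.2
  obtain ⟨h1, h3⟩ := limit_of_concentrated
    (π := fun k => (μ k : Measure (E n)).prod (μ k : Measure (E n)))
    (π₀ := (μ₀ : Measure (E n)).prod (μ₀ : Measure (E n)))
    (p := fun _ z => ‖z.1 - z.2‖) (p₀ := fun z => ‖z.1 - z.2‖)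
    (fun _ => by fun_prop) (by fun_prop) hconc hexc hmin
  obtain ⟨R, hb⟩ := exists_ae_norm_le h1
  refine ⟨h1, mean_eq_zero_of_tendsto h hc (C := 5) ?_ hb, h3⟩
  filter_upwards [hconc 1 one_pos] with k hk
  exact hk.second_moment_le (hc k)

lemma measure_singleton_pos_of_tendsto [l.NeBot] (h : Tendsto μ l (𝓝 μ₀))
    (h₀ : IsExtremal (μ₀ : Measure (E n))) {x : ι → E n} {x₀ : E n} (hx : Tendsto x l (𝓝 x₀))
    (hconc : ∀ η, 0 < η → ∀ᶠ k in l, Concentrated (μ k : Measure (E n)) (fun y => ‖x k - y‖)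
      (n / (n + 1)) η) : 0 < (μ₀ : Measure (E n)) {x₀} := by
  have hexc := tendsto_integral_of_bounded_of_dist h hx continuous_excess
    (fun t _ => by rw [Real.norm_of_nonneg (excess_nonneg _)]; exact excess_le_one _)
    zero_le_one fun s t _ _ => abs_excess_sub_le s t
  have hmin := tendsto_integral_of_bounded_of_dist h hx (F := fun t => min t 1 ^ 2) (by fun_prop)
    (fun t ht => by
      have := min_one_sq_nonneg_le ht
      rw [Real.norm_of_nonneg this.1]; exact this.2)
    zero_le_two fun s t hs ht => abs_min_one_sq_sub_le hs ht
  obtain ⟨h1, h3⟩ := limit_of_concentrated (π := fun k => (μ k : Measure (E n)))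
    (π₀ := (μ₀ : Measure (E n))) (p := fun k y => ‖x k - y‖) (p₀ := fun y => ‖x₀ - y‖)
    (fun _ => by fun_prop) (by fun_prop) hconc hexc hmin
  exact h₀.measure_singleton_pos h1 h3

/-- Weak convergence puts nearly the right mass in a small tent at each vertex, and the tail bound
makes the remaining mass cheap to move. -/
lemma eventually_d2_le {v : Fin (n + 1) → E n} (hv : v ∈ unitSimplices n)
    (h : Tendsto μ l (𝓝 (uniformProbability v))) (hc : ∀ k, μ k ∈ centered n)
    (hconc : ∀ η, 0 < η → ∀ᶠ k in l, Concentrated ((μ k : Measure (E n)).prod (μ k : Measure (E n)))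
      (fun z => ‖z.1 - z.2‖) (n / (n + 1)) η) {ε : ℝ} (hε : 0 < ε) :
    ∀ᶠ k in l, d2 (μ k) (uniformProbability v) ≤ ENNReal.ofReal ε := by
  -- Each of δ², 10τ and 2η is at most ε²/4, so the total cost stays below ε².
  set δ := min (1 / 2) (ε / 2)
  set τ := min (1 / 2) (ε ^ 2 / 40)
  set η := min 1 (ε ^ 2 / 8)
  have hδ : 0 < δ := lt_min (by norm_num) (by positivity)
  have hτ : 0 < τ := lt_min (by norm_num) (by positivity)
  have hη : 0 < η := lt_min (by norm_num) (by positivity)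
  have hδ1 : δ ≤ 1 / 2 := min_le_left _ _
  have hτ1 : τ ≤ 1 / 2 := min_le_left _ _
  have hη1 : η ≤ 1 := min_le_left _ _
  have hδ2 : δ ≤ ε / 2 := min_le_right _ _
  have hτ2 : τ ≤ ε ^ 2 / 40 := min_le_right _ _
  have hη2 : η ≤ ε ^ 2 / 8 := min_le_right _ _
  have hm : ∀ i, ∀ᶠ k in l, 1 - τ ≤ (n + 1) * ∫ x, tent δ (v i) x ∂(μ k : Measure (E n)) := by
    intro i
    have ht := (tendsto_integral_of_bounded h (continuous_tent δ (v i)) (C := 1) fun x => by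
      rw [Real.norm_of_nonneg (tent_nonneg _ _ _)]; exact tent_le_one hδ _ _).const_mul
        ((n : ℝ) + 1)
    refine (ht.eventually_const_lt ?_).mono fun k hk => hk.le
    have := one_le_integral_tent v (δ := δ) i
    simp only [coe_uniformProbability]
    linarith
  filter_upwards [eventually_all.2 hm, hconc η hη] with k hk hkc
  refine d2_uniformProbability_le_of_tent (hc k) hη.le hη1 hkc.integrable_tail
    hkc.integral_tail_le hv hδ hδ1 (θ := 1 - τ) (by linarith) hk hε.le ?_
  have := pow_le_pow_left₀ hδ.le hδ2 2
  nlinarith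

end Limit

/-- Prokhorov's theorem; an ultrafilter replaces the extraction of subsequences. -/
lemma exists_tendsto_ultrafilter {ι : Type*} (U : Ultrafilter ι)
    {μ : ι → ProbabilityMeasure (E n)} (hc : ∀ k, μ k ∈ centered n) {C : ℝ}
    (hC : ∀ᶠ k in (U : Filter ι), ∫ x, ‖x‖ ^ 2 ∂(μ k : Measure (E n)) ≤ C) :
    ∃ μ₀, Tendsto μ U (𝓝 μ₀) := by
  have hK := isCompact_closure_of_isTightMeasureSet (isTightMeasureSet_of_second_moment (n := n) C)
  obtain ⟨μ₀, -, h⟩ := hK.ultrafilter_le_nhds (U.map μ) (by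
    rw [Ultrafilter.coe_map, le_principal_iff, mem_map]
    filter_upwards [hC] with k hk
    exact subset_closure ⟨(hc k).1, hk⟩)
  exact ⟨μ₀, h⟩

end MildRepulsion

/-! ### The compactness argument -/

theorem propositionP (n : ℕ) (β : ℝ) (hβ : 2 ≤ β) (r : ℝ) (hr : 0 < r) :
    ∃ α₀ : ℝ, ∀ α : ℝ, α₀ ≤ α →
      ∀ μ ∈ MildRepulsion.argmin (MildRepulsion.centered n)
          (MildRepulsion.energy (MildRepulsion.powerLaw α β)),
        ∃ μhat ∈ MildRepulsion.hardMinimizers n β,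
          (∀ x ∈ MildRepulsion.argmin Set.univ
              (MildRepulsion.potential (MildRepulsion.powerLaw α β) μ),
            ∃ y ∈ (μhat : MeasureTheory.Measure (MildRepulsion.E n)).support, dist x y < r) ∧
          MildRepulsion.d2 μ μhat =
            MildRepulsion.d2Set μ (MildRepulsion.hardMinimizers n β) := by
  open MildRepulsion in
  by_contra hcon
  push Not at hcon
  choose α hα μ hμ H using fun k : ℕ => hcon k
  -- Fixing a closest hard minimizer first makes the negated claim produce a minimum point far from
  -- its support.
  choose ν hν hd using fun k => exists_hardMinimizer_closest hβ (μ k)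
  have hx : ∀ k, ∃ x ∈ argmin Set.univ (potential (powerLaw (α k) β) (μ k)),
      ∀ y ∈ (ν k : Measure (E n)).support, r ≤ dist x y := by
    intro k
    by_contra hk
    push Not at hk
    exact H k (ν k) (hν k) hk (hd k)
  choose x hxm hxd using hx
  set U : Ultrafilter ℕ := Filter.hyperfilter ℕ
  have hU : (U : Filter ℕ) ≤ Filter.atTop := Nat.hyperfilter_le_atTop
  have hc : ∀ k, μ k ∈ centered n := fun k => (hμ k).1
  have hev : ∀ η, 0 < η → ∀ᶠ k in (U : Filter ℕ),
      Concentrated ((μ k : Measure (E n)).prod (μ k : Measure (E n))) (fun z => ‖z.1 - z.2‖)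
        (n / (n + 1)) η ∧
      Concentrated (μ k : Measure (E n)) (fun y => ‖x k - y‖) (n / (n + 1)) η := by
    intro η hη
    obtain ⟨α₁, h₁⟩ := exists_forall_concentrated n hβ hη
    filter_upwards [hU (Filter.eventually_ge_atTop ⌈α₁⌉₊)] with k hk
    have hk' : α₁ ≤ α k := (Nat.le_ceil α₁).trans ((Nat.cast_le.2 hk).trans (hα k))
    exact ⟨(h₁ _ hk' _ (hμ k)).1, (h₁ _ hk' _ (hμ k)).2 _ (hxm k)⟩
  have hconc := fun η hη => (hev η hη).mono fun k hk => hk.1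
  have hconcx := fun η hη => (hev η hη).mono fun k hk => hk.2
  obtain ⟨μ₀, hμ₀⟩ := exists_tendsto_ultrafilter U hc
    ((hconc 1 one_pos).mono fun k hk => hk.second_moment_le (hc k))
  have hext : IsExtremal (μ₀ : Measure (E n)) := isExtremal_of_tendsto hμ₀ hc hconc
  obtain ⟨x₀, -, hx₀⟩ := (isCompact_closedBall (0 : E n) 3).ultrafilter_le_nhds (U.map x) (by
    rw [Ultrafilter.coe_map, Filter.le_principal_iff, Filter.mem_map]
    filter_upwards [hconcx 1 one_pos] with k hk
    simpa using hk.norm_le (hc k))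
  have hxt : Filter.Tendsto x U (nhds x₀) := hx₀
  have hpos := measure_singleton_pos_of_tendsto hμ₀ hext hxt hconcx
  obtain ⟨v, hv, hμv⟩ := hext.exists_eq_uniformMeasure
  obtain rfl : μ₀ = uniformProbability v := Subtype.ext hμv
  obtain ⟨i, rfl⟩ : ∃ i, v i = x₀ := by
    by_contra hne
    push Not at hne
    refine hpos.ne' ?_
    have : ∀ᵐ y ∂uniformMeasure v, y ≠ x₀ := ae_uniformMeasure hne
    simpa [ae_iff] using this
  have hρ : 0 < r / 4 := by positivity
  -- t² is half the mass 1/(n+1) of a vertex, so the tent mass of `μ k` at the limit vertex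
  -- eventually exceeds it.
  set t : ℝ := √(1 / (2 * (n + 1)))
  have ht : 0 < t := Real.sqrt_pos.2 (by positivity)
  have ht2 : t ^ 2 = 1 / (2 * (n + 1)) := Real.sq_sqrt (by positivity)
  have hmass : ∀ᶠ k in (U : Filter ℕ), t ^ 2 ≤ ∫ y, tent (r / 4) (v i) y ∂(μ k : Measure (E n)) := by
    have hlim := tendsto_integral_of_bounded hμ₀ (continuous_tent (r / 4) (v i)) (C := 1) fun y => by
      rw [Real.norm_of_nonneg (tent_nonneg _ _ _)]; exact tent_le_one hρ _ _
    refine (hlim.eventually_const_lt ?_).mono fun k hk => hk.le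
    have h1 := one_le_integral_tent v (δ := r / 4) i
    have hn : (0 : ℝ) < n + 1 := by positivity
    rw [ht2, coe_uniformProbability, div_lt_iff₀ (by positivity)]
    linarith
  -- The tolerance is half of the lower bound (r/4)·t that `le_d2_of_support` provides. With x_k
  -- within r/2 of the vertex, the support of `ν k` stays at distance at least r/2 = 2·(r/4) from
  -- it.
  obtain ⟨k, hk1, hk2, hk3⟩ := (hmass.and ((eventually_d2_le hv hμ₀ hc hconc
    (ε := r / 4 * t / 2) (by positivity)).and
    (hxt.eventually (Metric.ball_mem_nhds (v i) (ε := r / 2) (by positivity))))).exists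
  have hsupp : ∀ y ∈ (ν k : Measure (E n)).support, 2 * (r / 4) ≤ ‖v i - y‖ := by
    intro y hy
    have h1 := hxd k y hy
    have h2 : dist (x k) (v i) < r / 2 := hk3
    have h3 := dist_triangle (x k) (v i) y
    rw [← dist_eq_norm]
    linarith
  have hlow := le_d2_of_support (μ k) (ν k) hρ hsupp ht.le hk1
  have hup : d2 (μ k) (ν k) ≤ ENNReal.ofReal (r / 4 * t / 2) := by
    rw [hd k]
    refine le_trans (iInf₂_le (uniformProbability v) ?_) hk2
    exact (mem_hardMinimizers_iff hβ).2 hext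
  have hfin := (ENNReal.ofReal_le_ofReal_iff (by positivity)).1 (hlow.trans hup)
  have : 0 < r / 4 * t := by positivity
  linarith
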